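/- **Theorem (Longitudinal identification with flip interventions).** *Setup.* Let $T,d\in\mathbb N$ and let observed data $Z=(X_1,A_1,\dots,X_T,A_T,Y)$, with $X_t\in\mathbb R^d$, $A_t\in\{0,1\}$, $Y\in\mathbb R$, follow a nonparametric structural equation model (NPSEM): with $\overline O_t=(O_1,\dots,O_t)$ and $H_t=(\overline X_t,\overline A_{t-1})$, $$X_t=f_{X,t}(A_{t-1},H_{t-1},U_{X,t}),\qquad A_t=f_{A,t}(H_t,U_{A,t}),\qquad Y=f_Y(A_T,H_T,U_Y),$$ for deterministic (measurable) functions $f_{X,t},f_{A,t},f_Y$ and exogenous random variables $U_{X,t},U_{A,t},U_Y$. If the treatment equations are replaced by interventions $\overline D_T=(D_1,\dots,D_T)$, the model generates recursively the counterfactuals $X_t(\overline D_{t-1})=f_{X,t}\{D_{t-1},H_{t-1}(\overline D_{t-2}),U_{X,t}\}$, $H_t(\overline D_{t-1})=\{\overline D_{t-1},\overline X_t(\overline D_{t-1})\}$, the natural value of treatment $A_t(\overline D_{t-1})=f_{A,t}\{H_t(\overline D_{t-1}),U_{A,t}\}$, and $Y(\overline D_T)=f_Y\{D_T,H_T(\overline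 D_{T-1}),U_Y\}$. Fix a target regime $\overline a_T\in\{0,1\}^T$ and measurable weight functions $f_t$ from the space of values of $H_t$ to $[0,1]$. Let $V_1,\dots,V_T$ be iid $\mathrm{Unif}(0,1)$ and jointly independent of the family of all the variables $X_t(\overline b_{t-1})$, $A_t(\overline b_{t-1})$, $Y(\overline b_T)$, $t\le T$, $\overline b_T\in\{0,1\}^T$ (hence also of $Z$). The sequence of flip interventions $\overline D=\overline D_{\overline f}(\overline a_T)$, with components $D_t=D_{f_t}(a_t)$, is defined recursively by $$D_{f_t}(a_t)=\begin{cases}A_t(\overline D_{t-1}),&\text{if }A_t(\overline D_{t-1})=a_t,\\ a_t\,\mathbb 1[V_t\le f_t\{H_t(\overline D_{t-1})\}]+A_t(\overline D_{t-1})\,\mathbb 1[V_t> f_t\{H_t(\overline D_{t-1})\}],&\text{otherwise.}\end{cases}$$ *Assumptions.* Suppose strong sequential randomization holds: for every $t\le T$, $U_{A,t}$ is conditionally independent of $\{(U_{X,s},U_{A,s})_{t<s\le T},U_Y\}$ given $H_t$. Suppose moreover that one of the following holds: 1. for every $t\le T$, almost surely, $\mathbb P(A_t=a_t\mid H_t)=0$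 implies $f_t(H_t)=0$; 2. for every $t\le T$, $\mathbb P\{\mathbb P(A_t=a_t\mid H_t)=0\}=0$. *Conclusion.* Put $Q_t(a_t\mid h_t)=\mathbb P(A_t=a_t\mid h_t)+f_t(h_t)\{1-\mathbb P(A_t=a_t\mid h_t)\}$ and $Q_t(1-a_t\mid h_t)=1-Q_t(a_t\mid h_t)$. If $\mathbb E|Y(\overline D_{\overline f}(\overline a_T))|<\infty$, then all the integrals below converge absolutely and $$\mathbb E\big[Y\{\overline D_{\overline f}(\overline a_T)\}\big]=\sum_{\overline b_T\in\{0,1\}^T}\int \mathbb E(Y\mid\overline A_T=\overline b_T,\overline X_T=\overline x_T)\prod_{t=1}^TQ_t(b_t\mid\overline b_{t-1},\overline x_t)\,d\mathbb P(x_t\mid\overline b_{t-1},\overline x_{t-1})=\mathbb E\Big[Y\prod_{t=1}^T\frac{Q_t(A_t\mid H_t)}{\mathbb P(A_t\mid H_t)}\Big].$$ Moreover, for every $t\in\{1,\dots,T\}$ (without the moment condition), the integrals below converge absolutely and $$\mathbb E\{D_{f_t}(a_t)\}=\sum_{\overline b_{t-1}\in\{0,1\}^{t-1}}\int Q_t(1\mid\overline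 b_{t-1},\overline x_t)\,d\mathbb P(x_t\mid\overline b_{t-1},\overline x_{t-1})\prod_{s=1}^{t-1}Q_s(b_s\mid\overline b_{s-1},\overline x_s)\,d\mathbb P(x_s\mid\overline b_{s-1},\overline x_{s-1})=\mathbb E\Big[Q_t(1\mid H_t)\prod_{s=1}^{t-1}\frac{Q_s(A_s\mid H_s)}{\mathbb P(A_s\mid H_s)}\Big].$$ Here conditional probabilities, conditional laws and the outcome regression are taken from regular conditional distributions of the observed variables. -/

import Mathlib

open MeasureTheory ProbabilityTheory

/-- Covariate values, `ℝ^d`. -/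
abbrev Cov (d : ℕ) : Type := Fin d → ℝ

/-- `Past d t`: the covariates and treatments of the first `t` timepoints. Time is counted from `0`,
so timepoint `t` here is the `(t + 1)`-st one. -/
abbrev Past (d t : ℕ) : Type := (Fin t → Cov d) × (Fin t → Fin 2)

/-- `Hist d t`: values of the history just before treatment at timepoint `t`, i.e. the covariates of
timepoints `0, …, t` and the treatments of timepoints `0, …, t - 1`. -/
abbrev Hist (d t : ℕ) : Type := (Fin (t + 1) → Cov d) × (Fin t → Fin 2)

/-- Conditional independence of the random elements `U` and `W` given the random element `H`:
`P(U ∈ s, W ∈ r | H) = P(U ∈ s | H) P(W ∈ r | H)` almost surely, for all measurable `s`, `r`.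
(It needs no regularity of `Ω`; on a standard Borel `Ω` it is Mathlib's `CondIndepFun`.) -/
def CondIndepGiven {Ω α β γ : Type*} [MeasurableSpace Ω] [MeasurableSpace α] [MeasurableSpace β]
    [mγ : MeasurableSpace γ] (μ : Measure Ω) (U : Ω → α) (W : Ω → β) (H : Ω → γ) : Prop :=
  ∀ (s : Set α) (r : Set β), MeasurableSet s → MeasurableSet r →
    μ⟦U ⁻¹' s ∩ W ⁻¹' r | mγ.comap H⟧ =ᵐ[μ]
      μ⟦U ⁻¹' s | mγ.comap H⟧ * μ⟦W ⁻¹' r | mγ.comap H⟧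

/-- A rule assigning treatment at every timepoint `t`: it may use the sample point `ω` (so
that arbitrary random treatments are allowed), the history under the rule, and the natural value of
treatment under the rule. -/
abbrev Regime (Ω : Type*) (d : ℕ) : Type _ := ∀ t : ℕ, Ω → Hist d t → Fin 2 → Fin 2

/-- A nonparametric structural equation model on `Ω` with `T` timepoints: structural functions and
exogenous random variables, the latter with values in arbitrary measurable spaces.
Only the timepoints `t < T` play a role. -/
structure NPSEM (Ω : Type*) [MeasurableSpace Ω] (d T : ℕ) (EX EA : ℕ → Type*) (EY : Type*)
    [∀ t, MeasurableSpace (EX t)] [∀ t, MeasurableSpace (EA t)] [MeasurableSpace EY] where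
  fX : ∀ t : ℕ, Past d t → EX t → Cov d
  fA : ∀ t : ℕ, Hist d t → EA t → Fin 2
  fY : Past d T → EY → ℝ
  UX : ∀ t : ℕ, Ω → EX t
  UA : ∀ t : ℕ, Ω → EA t
  UY : Ω → EY
  measurable_fX : ∀ t, Measurable (Function.uncurry (fX t))
  measurable_fA : ∀ t, Measurable (Function.uncurry (fA t))
  measurable_fY : Measurable (Function.uncurry fY)
  measurable_UX : ∀ t, Measurable (UX t)
  measurable_UA : ∀ t, Measurable (UA t)
  measurable_UY : Measurable UY

namespace NPSEM

variable {Ω : Type*} [MeasurableSpace Ω] {d T : ℕ} {EX EA : ℕ → Type*} {EY : Type*}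
  [∀ t, MeasurableSpace (EX t)] [∀ t, MeasurableSpace (EA t)] [MeasurableSpace EY]

/-! ### Counterfactual and observed variables -/

/-- Covariates and assigned treatments of the first `t` timepoints when the treatment equations are
replaced by the rule `g`. -/
def pastUnder (S : NPSEM Ω d T EX EA EY) (g : Regime Ω d) : ∀ t : ℕ, Ω → Past d t
  | 0, _ => (Fin.elim0, Fin.elim0)
  | t + 1, ω =>
    let p : Past d t := S.pastUnder g t ω
    let h : Hist d t := (Fin.snoc (α := fun _ => Cov d) p.1 (S.fX t p (S.UX t ω)), p.2)
    (h.1, Fin.snoc (α := fun _ => Fin 2) p.2 (g t ω h (S.fA t h (S.UA t ω))))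

/-- The counterfactual covariate `X_t(D̄_{t-1})`. -/
def covUnder (S : NPSEM Ω d T EX EA EY) (g : Regime Ω d) (t : ℕ) (ω : Ω) : Cov d :=
  S.fX t (S.pastUnder g t ω) (S.UX t ω)

/-- The counterfactual history `H_t(D̄_{t-1})`. -/
def histUnder (S : NPSEM Ω d T EX EA EY) (g : Regime Ω d) (t : ℕ) (ω : Ω) : Hist d t :=
  (Fin.snoc (α := fun _ => Cov d) (S.pastUnder g t ω).1 (S.covUnder g t ω), (S.pastUnder g t ω).2)

/-- The natural value of treatment `A_t(D̄_{t-1})`. -/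
def naturalUnder (S : NPSEM Ω d T EX EA EY) (g : Regime Ω d) (t : ℕ) (ω : Ω) : Fin 2 :=
  S.fA t (S.histUnder g t ω) (S.UA t ω)

/-- The assigned treatment `D_t`. -/
def treatUnder (S : NPSEM Ω d T EX EA EY) (g : Regime Ω d) (t : ℕ) (ω : Ω) : Fin 2 :=
  g t ω (S.histUnder g t ω) (S.naturalUnder g t ω)

/-- The counterfactual outcome `Y(D̄_T)`. -/
def outcomeUnder (S : NPSEM Ω d T EX EA EY) (g : Regime Ω d) (ω : Ω) : ℝ :=
  S.fY (S.pastUnder g T ω) (S.UY ω)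

theorem pastUnder_succ (S : NPSEM Ω d T EX EA EY) (g : Regime Ω d) (t : ℕ) (ω : Ω) :
    S.pastUnder g (t + 1) ω = ((S.histUnder g t ω).1,
      Fin.snoc (α := fun _ => Fin 2) (S.pastUnder g t ω).2 (S.treatUnder g t ω)) := rfl

/-- No intervention: every treatment takes its natural value. -/
def noIntervention (Ω : Type*) (d : ℕ) : Regime Ω d := fun _ _ _ a => a

/-- The observed `(X̄, Ā)` of the first `t` timepoints. -/
def past (S : NPSEM Ω d T EX EA EY) (t : ℕ) : Ω → Past d t := S.pastUnder (noIntervention Ω d) t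

/-- The observed covariate `X_t`. -/
def X (S : NPSEM Ω d T EX EA EY) (t : ℕ) : Ω → Cov d := S.covUnder (noIntervention Ω d) t

/-- The observed history `H_t = (X̄_t, Ā_{t-1})`. -/
def H (S : NPSEM Ω d T EX EA EY) (t : ℕ) : Ω → Hist d t := S.histUnder (noIntervention Ω d) t

/-- The observed treatment `A_t`. -/
def A (S : NPSEM Ω d T EX EA EY) (t : ℕ) : Ω → Fin 2 := S.treatUnder (noIntervention Ω d) t

/-- The observed outcome `Y`. -/
def Y (S : NPSEM Ω d T EX EA EY) : Ω → ℝ := S.outcomeUnder (noIntervention Ω d)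

/-! The structural equations of the observed variables. -/

theorem X_eq (S : NPSEM Ω d T EX EA EY) (t : ℕ) (ω : Ω) :
    S.X t ω = S.fX t (S.past t ω) (S.UX t ω) := rfl

theorem A_eq (S : NPSEM Ω d T EX EA EY) (t : ℕ) (ω : Ω) :
    S.A t ω = S.fA t (S.H t ω) (S.UA t ω) := rfl

theorem Y_eq (S : NPSEM Ω d T EX EA EY) (ω : Ω) : S.Y ω = S.fY (S.past T ω) (S.UY ω) := rfl

theorem H_eq (S : NPSEM Ω d T EX EA EY) (t : ℕ) (ω : Ω) :
    S.H t ω = (Fin.snoc (α := fun _ => Cov d) (S.past t ω).1 (S.X t ω), (S.past t ω).2) := rfl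

theorem past_succ (S : NPSEM Ω d T EX EA EY) (t : ℕ) (ω : Ω) :
    S.past (t + 1) ω =
      (Fin.snoc (α := fun _ => Cov d) (S.past t ω).1 (S.X t ω),
        Fin.snoc (α := fun _ => Fin 2) (S.past t ω).2 (S.A t ω)) := rfl

/-- The static intervention setting the treatments of the timepoints `t < T` to `b`. -/
def static (Ω : Type*) (d : ℕ) {T : ℕ} (b : Fin T → Fin 2) : Regime Ω d :=
  fun t _ _ a => if ht : t < T then b ⟨t, ht⟩ else a

/-- All potential covariates `X_t(b̄_{t-1})`, natural treatments `A_t(b̄_{t-1})` and outcomes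
`Y(b̄_T)` under the static interventions `b̄ ∈ {0,1}^T`, as one random element. -/
def potentials (S : NPSEM Ω d T EX EA EY) (ω : Ω) :
    (Fin T → Fin 2) → (Fin T → Cov d) × (Fin T → Fin 2) × ℝ :=
  fun b => (fun t => S.covUnder (static Ω d b) t ω, fun t => S.naturalUnder (static Ω d b) t ω,
    S.outcomeUnder (static Ω d b) ω)

/-- The exogenous variables of the timepoints after `t`, together with that of the outcome. -/
def futureExogenous (S : NPSEM Ω d T EX EA EY) (t : ℕ) (ω : Ω) :
    (∀ s : Set.Ioo t T, EX s) × (∀ s : Set.Ioo t T, EA s) × EY :=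
  (fun s => S.UX s ω, fun s => S.UA s ω, S.UY ω)

/-- Strong sequential randomization. -/
def StrongSequentialRandomization (S : NPSEM Ω d T EX EA EY) (μ : Measure Ω) : Prop :=
  ∀ t < T, CondIndepGiven μ (S.UA t) (S.futureExogenous t) (S.H t)

/-- The sequence of flip interventions targeting `a`, with weight functions `f` and auxiliary random
variables `V`. -/
noncomputable def flip (a : ℕ → Fin 2) (f : ∀ t : ℕ, Hist d t → ℝ) (V : ℕ → Ω → ℝ) :
    Regime Ω d :=
  fun t ω h natural =>
    if natural = a t then natural else if V t ω ≤ f t h then a t else natural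

/-! ### Observed-data quantities -/

/-- The propensity score `P(A_t = b | H_t = h)`. -/
noncomputable def propensity (S : NPSEM Ω d T EX EA EY) (μ : Measure Ω) [IsFiniteMeasure μ] (t : ℕ)
    (b : Fin 2) (h : Hist d t) : ℝ :=
  (condDistrib (S.A t) (S.H t) μ h).real {b}

/-- The intervention propensity score `Q_t(b | h)`: at the target `b = a_t` it is
`P(A_t = a_t | h) + f_t(h) {1 - P(A_t = a_t | h)}`, at the other value it is one minus this. -/
noncomputable def Q (S : NPSEM Ω d T EX EA EY) (μ : Measure Ω) [IsFiniteMeasure μ] (a : ℕ → Fin 2)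
    (f : ∀ t : ℕ, Hist d t → ℝ) (t : ℕ) (b : Fin 2) (h : Hist d t) : ℝ :=
  if b = a t then S.propensity μ t (a t) h + f t h * (1 - S.propensity μ t (a t) h)
  else 1 - (S.propensity μ t (a t) h + f t h * (1 - S.propensity μ t (a t) h))

/-- The outcome regression `E(Y | X̄_T = x̄, Ā_T = b̄)`, the mean of the regular conditional
distribution of `Y`. -/
noncomputable def outcomeRegression (S : NPSEM Ω d T EX EA EY) (μ : Measure Ω) [IsFiniteMeasure μ]
    (x : Fin T → Cov d) (b : Fin T → Fin 2) : ℝ :=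
  ∫ y, y ∂(condDistrib S.Y (S.past T) μ (x, b))

/-- The conditional law `dP(x_t | b̄_{t-1}, x̄_{t-1})` of `X_t` given the past, as a kernel in
`x̄_{t-1}` for fixed `b̄_{t-1}`. -/
noncomputable def covKernel (S : NPSEM Ω d T EX EA EY) (μ : Measure Ω) [IsFiniteMeasure μ] (t : ℕ)
    (b : Fin t → Fin 2) : Kernel (Fin t → Cov d) (Cov d) :=
  (condDistrib (S.X t) (S.past t) μ).sectL b

/-- The measure `∏_{s < t} dP(x_s | b̄_{s-1}, x̄_{s-1})` on the covariates of the first `t`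
timepoints. -/
noncomputable def pastLaw (S : NPSEM Ω d T EX EA EY) (μ : Measure Ω) [IsFiniteMeasure μ] :
    ∀ t : ℕ, (Fin t → Fin 2) → Measure (Fin t → Cov d)
  | 0, _ => Measure.dirac Fin.elim0
  | t + 1, b =>
    ((S.pastLaw μ t (Fin.init b)).compProd (S.covKernel μ t (Fin.init b))).map
      fun p => Fin.snoc (α := fun _ => Cov d) p.1 p.2

/-- The measure `∏_{s ≤ t} dP(x_s | b̄_{s-1}, x̄_{s-1})` on the covariates of the timepoints
`0, …, t`. -/
noncomputable def histLaw (S : NPSEM Ω d T EX EA EY) (μ : Measure Ω) [IsFiniteMeasure μ] (t : ℕ)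
    (b : Fin t → Fin 2) : Measure (Fin (t + 1) → Cov d) :=
  ((S.pastLaw μ t b).compProd (S.covKernel μ t b)).map
    fun p => Fin.snoc (α := fun _ => Cov d) p.1 p.2

/-- The history `(x̄_s, b̄_{s-1})` before treatment at timepoint `s`, cut out of the paths
`x` and `b`. -/
def cutHist {n : ℕ} (x : Fin n → Cov d) (b : Fin n → Fin 2) (s : Fin n) : Hist d s :=
  (fun i => x (i.castLE s.isLt), fun i => b (i.castLE s.isLt.le))

/-- `∏_s Q_s(b_s | b̄_{s-1}, x̄_s)` along the paths `x` and `b` of length `n`. -/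
noncomputable def QProd (S : NPSEM Ω d T EX EA EY) (μ : Measure Ω) [IsFiniteMeasure μ]
    (a : ℕ → Fin 2) (f : ∀ t : ℕ, Hist d t → ℝ) {n : ℕ} (x : Fin n → Cov d) (b : Fin n → Fin 2) :
    ℝ :=
  ∏ s : Fin n, S.Q μ a f s (b s) (cutHist x b s)

/-- The inverse probability weight `∏_{s < n} Q_s(A_s | H_s) / P(A_s | H_s)`. -/
noncomputable def ipw (S : NPSEM Ω d T EX EA EY) (μ : Measure Ω) [IsFiniteMeasure μ]
    (a : ℕ → Fin 2) (f : ∀ t : ℕ, Hist d t → ℝ) (n : ℕ) (ω : Ω) : ℝ :=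
  ∏ s ∈ Finset.range n,
    S.Q μ a f s (S.A s ω) (S.H s ω) / S.propensity μ s (S.A s ω) (S.H s ω)

end NPSEM

open scoped ENNReal

/-!
The proof compares two laws on the observable variables: the law under the flip intervention, and the
observed law reweighted by `∏ Q_s(A_s | H_s) / P(A_s | H_s)`.

*From flips to weights.* At each sample point, exactly one static treatment path `b` is reproduced
by the flips made along it, and in the flip world every variable takes its value in the static world
of that path (`NPSEM.apply_flip_eq_sum`). For fixed `b` all these values are potential variables, of
which the uniform variables are independent, so that Fubini's theorem replaces the event that the
flips reproduce `b` by a product of flip probabilities (`NPSEM.lintegral_prod_flipValue`). These are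
then exchanged one timepoint at a time (`NPSEM.lintegral_hybrid_succ`): with treatment natural
before `k` and set to `b` from `k` on, all variables after `k` are functions of `H_k` and of later
exogenous variables, from which `A_k` is independent given `H_k`. Hence the flip probability at `k`
may be averaged to `Q_k(b_k | H_k)`, and this in turn is the average of the weighted indicator
`1{A_k = b_k} Q_k(b_k | H_k) / P(b_k | H_k)`. The division is harmless because, under either
positivity assumption, `Q_k(b_k | H_k)` vanishes almost surely where the propensity score does
(`NPSEM.propensity_mul_weight`). On `A_k = b_k` setting `A_k` to `b_k` changes nothing, which leads
to the situation with `k + 1` in place of `k`. After the last step all variables are observed ones;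
summing over `b` gives `NPSEM.lintegral_flip`.

*From weights to the g-formula.* Under the reweighted law the covariates still have their observed
conditional laws, and the treatments have conditional probabilities `Q_t`; unrolling this in time
gives `NPSEM.lintegral_past` and `NPSEM.lintegral_hist`.

These identities hold for all nonnegative measurable functions and thus are identities of measures.
In particular, the law of the outcome under the flip intervention is the reweighted observed law of
`Y` (`NPSEM.map_outcomeUnder_flip`), so that integrability of the counterfactual outcome carries
over to the reweighted observed one, although `Y` itself need not be integrable.
-/

/-! ### Appending a coordinate -/

theorem measurable_finSnoc {α : Type*} [MeasurableSpace α] (n : ℕ) :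
    Measurable fun p : (Fin n → α) × α => Fin.snoc (α := fun _ => α) p.1 p.2 := by
  refine measurable_pi_iff.2 fun i => ?_
  refine Fin.lastCases ?_ (fun j => ?_) i
  · simpa using measurable_snd
  · simpa [Function.comp_def] using (measurable_pi_apply j).comp measurable_fst

theorem Measurable.finSnoc {α β : Type*} {_ : MeasurableSpace α} {_ : MeasurableSpace β} {n : ℕ}
    {u : β → Fin n → α} {v : β → α} (hu : Measurable u) (hv : Measurable v) :
    Measurable fun x => Fin.snoc (α := fun _ => α) (u x) (v x) :=
  (measurable_finSnoc n).comp (hu.prodMk hv)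

/-- Summing over paths of length `t + 1` is summing over paths of length `t` and the last value. -/
theorem sum_path_succ {M β : Type*} [AddCommMonoid M] [Fintype β] {t : ℕ}
    (F : (Fin (t + 1) → β) → M) :
    ∑ b, F b = ∑ c : β, ∑ b : Fin t → β, F (Fin.snoc (α := fun _ => β) b c) := by
  rw [← Fintype.sum_prod_type', ← (Fin.snocEquiv fun _ : Fin (t + 1) => β).sum_comp]
  rfl

namespace NPSEM

variable {Ω : Type*} [MeasurableSpace Ω] {d T : ℕ} {EX EA : ℕ → Type*} {EY : Type*}
  [∀ t, MeasurableSpace (EX t)] [∀ t, MeasurableSpace (EA t)] [MeasurableSpace EY]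

/-! ### The variables generated by a regime -/

/-- Two regimes generate the same past at a sample point as soon as they agree there along the
path of the first one. -/
theorem pastUnder_congr (S : NPSEM Ω d T EX EA EY) {g g' : Regime Ω d} {ω : Ω} {t : ℕ}
    (h : ∀ s < t, S.treatUnder g s ω = g' s ω (S.histUnder g s ω) (S.naturalUnder g s ω)) :
    S.pastUnder g t ω = S.pastUnder g' t ω := by
  induction t with
  | zero => rfl
  | succ t ih =>
    have e := ih fun s hs => h s (hs.trans t.lt_succ_self)
    have eh : S.histUnder g t ω = S.histUnder g' t ω := by
      simp only [histUnder, covUnder, e]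
    have en : S.naturalUnder g t ω = S.naturalUnder g' t ω := by
      simp only [naturalUnder, eh]
    rw [pastUnder_succ, pastUnder_succ, h t t.lt_succ_self, e, eh, en]
    rfl

theorem histUnder_congr (S : NPSEM Ω d T EX EA EY) {g g' : Regime Ω d} {ω : Ω} {t : ℕ}
    (h : S.pastUnder g t ω = S.pastUnder g' t ω) : S.histUnder g t ω = S.histUnder g' t ω := by
  simp only [histUnder, covUnder, h]

theorem pastUnder_eq (S : NPSEM Ω d T EX EA EY) (g : Regime Ω d) (t : ℕ) (ω : Ω) :
    S.pastUnder g t ω =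
      (fun i : Fin t => S.covUnder g i ω, fun i : Fin t => S.treatUnder g i ω) := by
  induction t with
  | zero => exact Prod.ext (funext fun i => i.elim0) (funext fun i => i.elim0)
  | succ t ih =>
    rw [pastUnder_succ]
    refine Prod.ext (funext fun i => ?_) (funext fun i => ?_)
    · refine Fin.lastCases ?_ (fun j => ?_) i
      · simp [histUnder]
      · simp [histUnder, ih]
    · refine Fin.lastCases ?_ (fun j => ?_) i
      · simp
      · simp [ih]

theorem histUnder_eq (S : NPSEM Ω d T EX EA EY) (g : Regime Ω d) (t : ℕ) (ω : Ω) :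
    S.histUnder g t ω =
      (fun i : Fin (t + 1) => S.covUnder g i ω, fun i : Fin t => S.treatUnder g i ω) := by
  refine Prod.ext ?_ ?_
  · have h := congrArg Prod.fst (S.pastUnder_eq g (t + 1) ω)
    exact h
  · have h := congrArg Prod.snd (S.pastUnder_eq g t ω)
    exact h

theorem treatUnder_static (S : NPSEM Ω d T EX EA EY) (b : Fin T → Fin 2) (s : Fin T) (ω : Ω) :
    S.treatUnder (static Ω d b) s ω = b s := by
  simp [treatUnder, static]

theorem histUnder_static (S : NPSEM Ω d T EX EA EY) (b : Fin T → Fin 2) (s : Fin T) (ω : Ω) :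
    S.histUnder (static Ω d b) s ω = cutHist (S.potentials ω b).1 b s := by
  rw [histUnder_eq]
  refine Prod.ext rfl (funext fun i => ?_)
  exact S.treatUnder_static b (i.castLE s.isLt.le) ω

theorem pastUnder_static (S : NPSEM Ω d T EX EA EY) (b : Fin T → Fin 2) (ω : Ω) :
    S.pastUnder (static Ω d b) T ω = ((S.potentials ω b).1, b) := by
  rw [pastUnder_eq]
  exact Prod.ext rfl (funext fun i => S.treatUnder_static b i ω)

/-- The regime is jointly measurable at timepoint `t`. -/
def RegimeMeasurable (g : Regime Ω d) (t : ℕ) : Prop :=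
  Measurable fun p : Ω × Hist d t × Fin 2 => g t p.1 p.2.1 p.2.2

theorem measurable_covUnder_of_pastUnder (S : NPSEM Ω d T EX EA EY) {g : Regime Ω d} {t : ℕ}
    (h : Measurable (S.pastUnder g t)) : Measurable (S.covUnder g t) :=
  (S.measurable_fX t).comp (h.prodMk (S.measurable_UX t))

theorem measurable_histUnder_of_pastUnder (S : NPSEM Ω d T EX EA EY) {g : Regime Ω d} {t : ℕ}
    (h : Measurable (S.pastUnder g t)) : Measurable (S.histUnder g t) :=
  (h.fst.finSnoc (S.measurable_covUnder_of_pastUnder h)).prodMk h.snd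

theorem measurable_naturalUnder_of_pastUnder (S : NPSEM Ω d T EX EA EY) {g : Regime Ω d} {t : ℕ}
    (h : Measurable (S.pastUnder g t)) : Measurable (S.naturalUnder g t) :=
  (S.measurable_fA t).comp ((S.measurable_histUnder_of_pastUnder h).prodMk (S.measurable_UA t))

theorem measurable_treatUnder_of_pastUnder (S : NPSEM Ω d T EX EA EY) {g : Regime Ω d} {t : ℕ}
    (hg : RegimeMeasurable g t) (h : Measurable (S.pastUnder g t)) :
    Measurable (S.treatUnder g t) :=
  hg.comp (measurable_id.prodMk ((S.measurable_histUnder_of_pastUnder h).prodMk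
    (S.measurable_naturalUnder_of_pastUnder h)))

theorem measurable_pastUnder (S : NPSEM Ω d T EX EA EY) {g : Regime Ω d} {t : ℕ}
    (hg : ∀ s < t, RegimeMeasurable g s) : Measurable (S.pastUnder g t) := by
  induction t with
  | zero => exact measurable_const
  | succ t ih =>
    have h := ih fun s hs => hg s (hs.trans t.lt_succ_self)
    exact (S.measurable_histUnder_of_pastUnder h).fst.prodMk
      (h.snd.finSnoc (S.measurable_treatUnder_of_pastUnder (hg t t.lt_succ_self) h))

theorem measurable_outcomeUnder (S : NPSEM Ω d T EX EA EY) {g : Regime Ω d}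
    (hg : ∀ s < T, RegimeMeasurable g s) : Measurable (S.outcomeUnder g) :=
  S.measurable_fY.comp ((S.measurable_pastUnder hg).prodMk S.measurable_UY)

theorem regimeMeasurable_noIntervention (t : ℕ) : RegimeMeasurable (noIntervention Ω d) t :=
  measurable_snd.snd

theorem regimeMeasurable_static (b : Fin T → Fin 2) (t : ℕ) :
    RegimeMeasurable (static Ω d b) t := by
  unfold RegimeMeasurable static
  split_ifs
  · exact measurable_const
  · exact measurable_snd.snd

theorem measurable_past (S : NPSEM Ω d T EX EA EY) (t : ℕ) : Measurable (S.past t) :=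
  S.measurable_pastUnder fun s _ => regimeMeasurable_noIntervention s

theorem measurable_X (S : NPSEM Ω d T EX EA EY) (t : ℕ) : Measurable (S.X t) :=
  S.measurable_covUnder_of_pastUnder (S.measurable_past t)

theorem measurable_H (S : NPSEM Ω d T EX EA EY) (t : ℕ) : Measurable (S.H t) :=
  S.measurable_histUnder_of_pastUnder (S.measurable_past t)

theorem measurable_A (S : NPSEM Ω d T EX EA EY) (t : ℕ) : Measurable (S.A t) :=
  S.measurable_naturalUnder_of_pastUnder (S.measurable_past t)

theorem measurable_Y (S : NPSEM Ω d T EX EA EY) : Measurable S.Y :=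
  S.measurable_outcomeUnder fun s _ => regimeMeasurable_noIntervention s

theorem measurable_potentials (S : NPSEM Ω d T EX EA EY) : Measurable S.potentials := by
  refine measurable_pi_iff.2 fun b => ?_
  unfold potentials
  have h (t : ℕ) : Measurable (S.pastUnder (static Ω d b) t) :=
    S.measurable_pastUnder fun s _ => regimeMeasurable_static b s
  exact (measurable_pi_iff.2 fun t : Fin T => S.measurable_covUnder_of_pastUnder (h t)).prodMk
    ((measurable_pi_iff.2 fun t : Fin T =>
      S.measurable_naturalUnder_of_pastUnder (h t)).prodMk
      (S.measurable_outcomeUnder fun s _ => regimeMeasurable_static b s))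

theorem measurable_futureExogenous (S : NPSEM Ω d T EX EA EY) (t : ℕ) :
    Measurable (S.futureExogenous t) := by
  unfold futureExogenous
  exact (measurable_pi_iff.2 fun s : Set.Ioo t T => S.measurable_UX s).prodMk
    ((measurable_pi_iff.2 fun s : Set.Ioo t T => S.measurable_UA s).prodMk S.measurable_UY)

theorem measurable_cutHist {n : ℕ} (b : Fin n → Fin 2) (s : Fin n) :
    Measurable fun x : Fin n → Cov d => cutHist x b s :=
  (measurable_pi_iff.2 fun _ => measurable_pi_apply _).prodMk measurable_const

theorem regimeMeasurable_flip {a : ℕ → Fin 2} {f : ∀ t : ℕ, Hist d t → ℝ} {V : ℕ → Ω → ℝ} {t : ℕ}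
    (hf : Measurable (f t)) (hV : Measurable (V t)) : RegimeMeasurable (flip a f V) t := by
  unfold RegimeMeasurable flip
  refine Measurable.ite ?_ measurable_snd.snd (Measurable.ite ?_ measurable_const measurable_snd.snd)
  · exact measurable_snd.snd (measurableSet_singleton (a t))
  · exact measurableSet_le (hV.comp measurable_fst) (hf.comp measurable_snd.fst)

end NPSEM

/-! ### Conditional independence -/

section CondIndep

variable {Ω α β γ : Type*} [MeasurableSpace Ω] [MeasurableSpace α] [MeasurableSpace β]
  [mγ : MeasurableSpace γ] {μ : Measure Ω} [IsFiniteMeasure μ] {U : Ω → α} {W : Ω → β} {H : Ω → γ}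

/-- If `U` and `W` are conditionally independent given `H`, then the law of `(H, U)` on the event
`W ∈ r` has a density with respect to the law of `(H, U)` that depends on `H` only, namely the
conditional probability of `W ∈ r` given `H`. -/
theorem CondIndepGiven.exists_map_restrict_eq (h : CondIndepGiven μ U W H) (hU : Measurable U)
    (hW : Measurable W) (hH : Measurable H) {r : Set β} (hr : MeasurableSet r) :
    ∃ g : γ → ℝ≥0∞, Measurable g ∧ (μ.restrict (W ⁻¹' r)).map (fun ω => (H ω, U ω)) =
      (μ.withDensity fun ω => g (H ω)).map fun ω => (H ω, U ω) := by
  have hm : mγ.comap H ≤ ‹MeasurableSpace Ω› := hH.comap_le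
  set c : Ω → ℝ := μ⟦W ⁻¹' r | mγ.comap H⟧ with hc
  have hcm : StronglyMeasurable[mγ.comap H] c := stronglyMeasurable_condExp
  obtain ⟨k, hk, hck⟩ := hcm.measurable.exists_eq_measurable_comp
  have hci : Integrable c μ := integrable_condExp
  have hc0 : 0 ≤ᵐ[μ] c :=
    condExp_nonneg (Filter.Eventually.of_forall fun ω =>
      Set.indicator_nonneg (fun _ _ => zero_le_one) ω)
  refine ⟨fun x => ENNReal.ofReal (k x), hk.ennreal_ofReal, ?_⟩
  have hgc (ω : Ω) : ENNReal.ofReal (k (H ω)) = ENNReal.ofReal (c ω) := by rw [hck]; rfl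
  simp_rw [hgc]
  have hHU : Measurable fun ω => (H ω, U ω) := hH.prodMk hU
  refine Measure.ext_prod fun {B s} hB hs => ?_
  have hpre : (fun ω => (H ω, U ω)) ⁻¹' (B ×ˢ s) = U ⁻¹' s ∩ H ⁻¹' B := by
    ext ω; simp [and_comm]
  have hE : MeasurableSet (U ⁻¹' s ∩ H ⁻¹' B) := (hU hs).inter (hH hB)
  rw [Measure.map_apply hHU (hB.prod hs), Measure.map_apply hHU (hB.prod hs), hpre,
    Measure.restrict_apply hE, withDensity_apply _ hE,
    ← ofReal_integral_eq_lintegral_ofReal hci.integrableOn (ae_restrict_of_ae hc0),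
    ← ofReal_measureReal]
  congr 1
  have hHB : MeasurableSet[mγ.comap H] (H ⁻¹' B) := ⟨B, hB, rfl⟩
  have hi1 : Integrable ((U ⁻¹' s).indicator fun _ => (1 : ℝ)) μ :=
    (integrable_const _).indicator (hU hs)
  have hi2 : Integrable (((U ⁻¹' s).indicator fun _ => (1 : ℝ)) * c) μ := by
    refine (hci.indicator (hU hs)).congr (Filter.Eventually.of_forall fun ω => ?_)
    by_cases hω : ω ∈ U ⁻¹' s <;> simp [hω]
  calc μ.real (U ⁻¹' s ∩ H ⁻¹' B ∩ W ⁻¹' r)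
      = ∫ ω in H ⁻¹' B, (U ⁻¹' s ∩ W ⁻¹' r).indicator (fun _ => (1 : ℝ)) ω ∂μ := by
        rw [integral_indicator_const _ ((hU hs).inter (hW hr)),
          measureReal_restrict_apply ((hU hs).inter (hW hr)), smul_eq_mul, mul_one]
        congr 1
        ext ω; simp; tauto
    _ = ∫ ω in H ⁻¹' B, (μ⟦U ⁻¹' s ∩ W ⁻¹' r | mγ.comap H⟧) ω ∂μ :=
        (setIntegral_condExp hm ((integrable_const _).indicator ((hU hs).inter (hW hr))) hHB).symm
    _ = ∫ ω in H ⁻¹' B, (μ⟦U ⁻¹' s | mγ.comap H⟧ * c) ω ∂μ :=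
        integral_congr_ae (ae_restrict_of_ae (h s r hs hr))
    _ = ∫ ω in H ⁻¹' B, (μ[((U ⁻¹' s).indicator fun _ => (1 : ℝ)) * c | mγ.comap H]) ω ∂μ :=
        integral_congr_ae (ae_restrict_of_ae
          (condExp_mul_of_stronglyMeasurable_right hcm hi2 hi1).symm)
    _ = ∫ ω in H ⁻¹' B, (((U ⁻¹' s).indicator fun _ => (1 : ℝ)) * c) ω ∂μ :=
        setIntegral_condExp hm hi2 hHB
    _ = ∫ ω in H ⁻¹' B, (U ⁻¹' s).indicator c ω ∂μ := by
        refine integral_congr_ae (Filter.Eventually.of_forall fun ω => ?_)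
        by_cases hω : ω ∈ U ⁻¹' s <;> simp [hω]
    _ = ∫ ω in U ⁻¹' s ∩ H ⁻¹' B, c ω ∂μ := by
        rw [integral_indicator (hU hs), Measure.restrict_restrict (hU hs)]

/-- If `U` and `W` are conditionally independent given `H`, an event of `(H, U)` with conditional
probability `p(H)` given `H` also has conditional probability `p(H)` given `(H, W)`. -/
theorem CondIndepGiven.lintegral_indicator_eq (h : CondIndepGiven μ U W H) (hU : Measurable U)
    (hW : Measurable W) (hH : Measurable H) {E : Set (γ × α)} (hE : MeasurableSet E)
    {p : γ → ℝ≥0∞} (hp : Measurable p)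
    (hEp : (μ.restrict {ω | (H ω, U ω) ∈ E}).map H = (μ.map H).withDensity p)
    {G : Ω → ℝ≥0∞} (hG : Measurable[MeasurableSpace.comap (fun ω => (H ω, W ω)) inferInstance] G) :
    ∫⁻ ω, {ω | (H ω, U ω) ∈ E}.indicator G ω ∂μ = ∫⁻ ω, p (H ω) * G ω ∂μ := by
  obtain ⟨G, hG', rfl⟩ := hG.exists_eq_measurable_comp
  clear hG
  have hp1 : Measurable fun x : γ × β => p x.1 := hp.comp measurable_fst
  have hHU : Measurable fun ω => (H ω, U ω) := hH.prodMk hU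
  have hHW : Measurable fun ω => (H ω, W ω) := hH.prodMk hW
  have hE' : MeasurableSet {ω | (H ω, U ω) ∈ E} := hHU hE
  -- Both laws are compared on rectangles `B ×ˢ r`; for fixed `r` each equals the integral of
  -- `p * g` over `H ∈ B`, where `g(H)` is the conditional probability of `W ∈ r`.
  have key : (μ.restrict {ω | (H ω, U ω) ∈ E}).map (fun ω => (H ω, W ω)) =
      (μ.map fun ω => (H ω, W ω)).withDensity fun x => p x.1 := by
    refine Measure.ext_prod fun {B r} hB hr => ?_
    obtain ⟨g, hg, hgr⟩ := h.exists_map_restrict_eq hU hW hH hr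
    have h1 : μ (({ω | (H ω, U ω) ∈ E} ∩ H ⁻¹' B) ∩ W ⁻¹' r) =
        ∫⁻ ω in {ω | (H ω, U ω) ∈ E} ∩ H ⁻¹' B, g (H ω) ∂μ := by
      have hS : MeasurableSet (E ∩ Prod.fst ⁻¹' B) := hE.inter (measurable_fst hB)
      have := DFunLike.congr_fun hgr (E ∩ Prod.fst ⁻¹' B)
      rw [Measure.map_apply hHU hS, Measure.map_apply hHU hS, Measure.restrict_apply (hHU hS),
        withDensity_apply _ (hHU hS)] at this
      exact this
    have h2 : ∫⁻ ω in {ω | (H ω, U ω) ∈ E} ∩ H ⁻¹' B, g (H ω) ∂μ =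
        ∫⁻ ω in H ⁻¹' B, p (H ω) * g (H ω) ∂μ := by
      have := congrArg (fun m : Measure γ => ∫⁻ x in B, g x ∂m) hEp
      beta_reduce at this
      rw [Measure.restrict_map hH hB, lintegral_map hg hH, Measure.restrict_restrict (hH hB),
        restrict_withDensity hB, lintegral_withDensity_eq_lintegral_mul _ hp hg,
        Measure.restrict_map hH hB, lintegral_map (hp.mul hg) hH, Set.inter_comm] at this
      exact this
    have h3 : ∫⁻ ω in H ⁻¹' B ∩ W ⁻¹' r, p (H ω) ∂μ =
        ∫⁻ ω in H ⁻¹' B, p (H ω) * g (H ω) ∂μ := by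
      have hφ : Measurable fun x : γ × α => p x.1 := hp.comp measurable_fst
      have hpH : Measurable fun ω => p (H ω) := hp.comp hH
      have hgH : Measurable fun ω => g (H ω) := hg.comp hH
      have hS : MeasurableSet (Prod.fst ⁻¹' B : Set (γ × α)) := measurable_fst hB
      have := congrArg (fun m : Measure (γ × α) => ∫⁻ x in Prod.fst ⁻¹' B, p x.1 ∂m) hgr
      beta_reduce at this
      rw [Measure.restrict_map hHU hS, lintegral_map hφ hHU, Measure.restrict_restrict (hHU hS),
        Measure.restrict_map hHU hS, lintegral_map hφ hHU, restrict_withDensity (hHU hS),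
        lintegral_withDensity_eq_lintegral_mul _ hgH hpH] at this
      refine this.trans (lintegral_congr fun ω => ?_)
      exact mul_comm _ _
    have hpre : (fun ω => (H ω, W ω)) ⁻¹' (B ×ˢ r) = H ⁻¹' B ∩ W ⁻¹' r := rfl
    rw [Measure.map_apply hHW (hB.prod hr), Measure.restrict_apply (hHW (hB.prod hr)),
      withDensity_apply _ (hB.prod hr), Measure.restrict_map hHW (hB.prod hr),
      lintegral_map hp1 hHW, hpre, h3, ← h2, ← h1]
    congr 1
    ext ω; simp; tauto
  calc ∫⁻ ω, {ω | (H ω, U ω) ∈ E}.indicator (G ∘ fun ω => (H ω, W ω)) ω ∂μ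
      = ∫⁻ x, G x ∂(μ.restrict {ω | (H ω, U ω) ∈ E}).map (fun ω => (H ω, W ω)) := by
        rw [lintegral_indicator hE', lintegral_map hG' hHW]; rfl
    _ = ∫⁻ ω, p (H ω) * (G ∘ fun ω => (H ω, W ω)) ω ∂μ := by
        rw [key, lintegral_withDensity_eq_lintegral_mul _ hp1 hG',
          lintegral_map (hp1.mul hG') hHW]
        rfl

end CondIndep

namespace NPSEM

variable {Ω : Type*} [MeasurableSpace Ω] {d T : ℕ} {EX EA : ℕ → Type*} {EY : Type*}
  [∀ t, MeasurableSpace (EX t)] [∀ t, MeasurableSpace (EA t)] [MeasurableSpace EY]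

/-! ### Propensity scores and weights -/

section Propensity

variable (S : NPSEM Ω d T EX EA EY) (μ : Measure Ω) [IsFiniteMeasure μ]

theorem measurable_propensity (t : ℕ) (b : Fin 2) : Measurable (S.propensity μ t b) :=
  (Kernel.measurable_coe _ (measurableSet_singleton b)).ennreal_toReal

theorem propensity_nonneg (t : ℕ) (b : Fin 2) (h : Hist d t) : 0 ≤ S.propensity μ t b h :=
  measureReal_nonneg

theorem propensity_le_one (t : ℕ) (b : Fin 2) (h : Hist d t) : S.propensity μ t b h ≤ 1 :=
  measureReal_le_one

theorem sum_propensity (t : ℕ) (h : Hist d t) : ∑ b, S.propensity μ t b h = 1 := by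
  unfold propensity
  rw [sum_measureReal_singleton]
  simp

theorem propensity_eq_one_sub (t : ℕ) {b c : Fin 2} (hbc : b ≠ c) (h : Hist d t) :
    S.propensity μ t b h = 1 - S.propensity μ t c h := by
  have := S.sum_propensity μ t h
  rw [Fin.sum_univ_two] at this
  fin_cases b <;> fin_cases c <;> simp at hbc ⊢ <;> linarith

/-- The history law on the event `A_t = b` has the propensity score as its density. -/
theorem map_restrict_treat (t : ℕ) (b : Fin 2) :
    (μ.restrict {ω | S.A t ω = b}).map (S.H t) =
      (μ.map (S.H t)).withDensity fun h => ENNReal.ofReal (S.propensity μ t b h) := by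
  have hm := (S.measurable_propensity μ t b).ennreal_ofReal
  ext B hB
  have hA : MeasurableSet {ω | S.A t ω = b} := S.measurable_A t (measurableSet_singleton b)
  rw [Measure.map_apply (S.measurable_H t) hB, Measure.restrict_apply (S.measurable_H t hB),
    withDensity_apply _ hB, Measure.restrict_map (S.measurable_H t) hB,
    lintegral_map hm (S.measurable_H t)]
  have he (h : Hist d t) : ENNReal.ofReal (S.propensity μ t b h) =
      condDistrib (S.A t) (S.H t) μ h {b} := ENNReal.ofReal_toReal (measure_ne_top _ _)
  simp_rw [he]
  exact (setLIntegral_preimage_condDistrib (S.measurable_H t) (S.measurable_A t).aemeasurable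
    (measurableSet_singleton b) hB).symm

variable (a : ℕ → Fin 2) (f : ∀ t : ℕ, Hist d t → ℝ)

theorem measurable_Q {t : ℕ} (hf : Measurable (f t)) (b : Fin 2) :
    Measurable (S.Q μ a f t b) := by
  have hp := S.measurable_propensity μ t (a t)
  have h := hp.add (hf.mul (measurable_const (a := (1 : ℝ)).sub hp))
  unfold Q
  split_ifs
  · exact h
  · exact measurable_const.sub h

theorem Q_nonneg {t : ℕ} {h : Hist d t} (hf : f t h ∈ Set.Icc (0 : ℝ) 1) (b : Fin 2) :
    0 ≤ S.Q μ a f t b h := by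
  have h0 := S.propensity_nonneg μ t (a t) h
  have h1 := S.propensity_le_one μ t (a t) h
  have hf0 := hf.1
  have hf1 := hf.2
  unfold Q
  split_ifs <;> nlinarith

theorem sum_Q (t : ℕ) (h : Hist d t) : ∑ b, S.Q μ a f t b h = 1 := by
  unfold Q
  rw [Fin.sum_univ_two]
  generalize a t = c
  fin_cases c <;> simp

/-- The ratio `Q_t(b | h) / P(A_t = b | h)` as an extended nonnegative real, `0` where the
propensity score vanishes. -/
noncomputable def weight (t : ℕ) (b : Fin 2) (h : Hist d t) : ℝ≥0∞ :=
  ENNReal.ofReal (S.Q μ a f t b h / S.propensity μ t b h)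

theorem measurable_weight {t : ℕ} (hf : Measurable (f t)) (b : Fin 2) :
    Measurable (S.weight μ a f t b) :=
  ((S.measurable_Q μ a f hf b).div (S.measurable_propensity μ t b)).ennreal_ofReal

/-- At a value of treatment that is never taken the intervention propensity score vanishes, so
that dividing by the propensity score and multiplying by it again changes nothing. For
the target value this is the positivity assumption; the other value is never flipped to. -/
theorem propensity_mul_weight {t : ℕ} {h : Hist d t}
    (hpos : S.propensity μ t (a t) h = 0 → f t h = 0) (b : Fin 2) :
    ENNReal.ofReal (S.propensity μ t b h) * S.weight μ a f t b h =
      ENNReal.ofReal (S.Q μ a f t b h) := by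
  rw [weight, ← ENNReal.ofReal_mul (S.propensity_nonneg μ t b h)]
  by_cases h0 : S.propensity μ t b h = 0
  · have hQ : S.Q μ a f t b h = 0 := by
      unfold Q
      split_ifs with hb
      · subst hb
        simp [h0, hpos h0]
      · have := S.propensity_eq_one_sub μ t hb h
        have h1 : S.propensity μ t (a t) h = 1 := by linarith
        simp [h1]
    simp [hQ]
  · rw [mul_div_cancel₀ _ h0]

/-- The inverse probability weight as an extended nonnegative real. -/
theorem ofReal_ipw {n : ℕ} (hf : ∀ t < n, ∀ h, f t h ∈ Set.Icc (0 : ℝ) 1) (ω : Ω) :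
    ENNReal.ofReal (S.ipw μ a f n ω) =
      ∏ s ∈ Finset.range n, S.weight μ a f s (S.A s ω) (S.H s ω) := by
  unfold ipw weight
  refine ENNReal.ofReal_prod_of_nonneg fun s hs => ?_
  exact div_nonneg (S.Q_nonneg μ a f (hf s (Finset.mem_range.1 hs) _) _)
    (S.propensity_nonneg μ s _ _)

theorem ipw_nonneg {n : ℕ} (hf : ∀ t < n, ∀ h, f t h ∈ Set.Icc (0 : ℝ) 1) (ω : Ω) :
    0 ≤ S.ipw μ a f n ω :=
  Finset.prod_nonneg fun s hs => div_nonneg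
    (S.Q_nonneg μ a f (hf s (Finset.mem_range.1 hs) _) _) (S.propensity_nonneg μ s _ _)

/-- `∏_{s < n} Q_s(A_s | H_s) / P(A_s | H_s)` as a function of the past. -/
noncomputable def pastWeight {n : ℕ} (p : Past d n) : ℝ≥0∞ :=
  ∏ s : Fin n, S.weight μ a f s (p.2 s) (cutHist p.1 p.2 s)

theorem measurable_pastWeight {n : ℕ} (hf : ∀ t < n, Measurable (f t)) :
    Measurable (S.pastWeight μ a f (n := n)) := by
  refine Finset.measurable_prod _ fun s _ => ?_
  have h : Measurable fun q : Hist d s × Fin 2 => S.weight μ a f s q.2 q.1 :=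
    measurable_from_prod_countable_left fun b => S.measurable_weight μ a f (hf s s.isLt) b
  have hc : Measurable fun p : Past d n => cutHist p.1 p.2 s :=
    (measurable_pi_iff.2 fun i => (measurable_pi_apply _).comp measurable_fst).prodMk
      (measurable_pi_iff.2 fun i => (measurable_pi_apply _).comp measurable_snd)
  exact h.comp (hc.prodMk ((measurable_pi_apply s).comp measurable_snd))

theorem cutHist_past (n : ℕ) (s : Fin n) (ω : Ω) :
    cutHist (S.past n ω).1 (S.past n ω).2 s = S.H s ω := by
  unfold past H
  rw [pastUnder_eq, histUnder_eq]
  rfl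

theorem past_snd (n : ℕ) (s : Fin n) (ω : Ω) : (S.past n ω).2 s = S.A s ω := by
  unfold past A
  rw [pastUnder_eq]

theorem pastWeight_past {n : ℕ} (hf : ∀ t < n, ∀ h, f t h ∈ Set.Icc (0 : ℝ) 1) (ω : Ω) :
    S.pastWeight μ a f (S.past n ω) = ENNReal.ofReal (S.ipw μ a f n ω) := by
  rw [ofReal_ipw S μ a f hf, pastWeight,
    ← Fin.prod_univ_eq_prod_range (fun s => S.weight μ a f s (S.A s ω) (S.H s ω)) n]
  exact Finset.prod_congr rfl fun s _ => by rw [cutHist_past, past_snd]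

theorem pastWeight_past_succ (n : ℕ) (ω : Ω) :
    S.pastWeight μ a f (S.past (n + 1) ω) =
      S.pastWeight μ a f (S.past n ω) * S.weight μ a f n (S.A n ω) (S.H n ω) := by
  simp only [pastWeight, cutHist_past, past_snd]
  rw [Fin.prod_univ_castSucc]
  rfl

end Propensity

/-- Splitting according to the treatment taken at timepoint `t`. -/
theorem lintegral_eq_sum_treat (S : NPSEM Ω d T EX EA EY) (μ : Measure Ω) {t : ℕ}
    {G : Fin 2 → Ω → ℝ≥0∞} (hG : ∀ b, Measurable (G b)) :
    ∫⁻ ω, G (S.A t ω) ω ∂μ = ∑ b, ∫⁻ ω, {ω | S.A t ω = b}.indicator (G b) ω ∂μ := by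
  have hm (b : Fin 2) : Measurable fun ω => {ω | S.A t ω = b}.indicator (G b) ω :=
    (hG b).indicator (S.measurable_A t (measurableSet_singleton b))
  rw [← lintegral_finsetSum _ fun b _ => hm b]
  refine lintegral_congr fun ω => ?_
  simp [Set.indicator_apply]

/-! ### Sequential randomization -/

section Randomization

variable {S : NPSEM Ω d T EX EA EY} {μ : Measure Ω} [IsFiniteMeasure μ]

/-- The σ-algebra generated by the history at timepoint `t` and the exogenous variables after `t`. -/
abbrev sigmaFuture (S : NPSEM Ω d T EX EA EY) (t : ℕ) : MeasurableSpace Ω :=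
  MeasurableSpace.comap (fun ω => (S.H t ω, S.futureExogenous t ω)) inferInstance

theorem sigmaFuture_le (S : NPSEM Ω d T EX EA EY) (t : ℕ) :
    S.sigmaFuture t ≤ ‹MeasurableSpace Ω› :=
  ((S.measurable_H t).prodMk (S.measurable_futureExogenous t)).comap_le

theorem measurable_sigmaFuture_H (S : NPSEM Ω d T EX EA EY) (t : ℕ) :
    Measurable[S.sigmaFuture t] (S.H t) :=
  measurable_fst.comp (comap_measurable fun ω => (S.H t ω, S.futureExogenous t ω))

theorem measurable_sigmaFuture_futureExogenous (S : NPSEM Ω d T EX EA EY) (t : ℕ) :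
    Measurable[S.sigmaFuture t] (S.futureExogenous t) :=
  measurable_snd.comp (comap_measurable fun ω => (S.H t ω, S.futureExogenous t ω))

/-- Strong sequential randomization as it is used: the conditional probability of `A_t = b` given
the history and all later exogenous variables is the propensity score. -/
theorem StrongSequentialRandomization.lintegral_treat (hSR : S.StrongSequentialRandomization μ)
    {t : ℕ} (ht : t < T) (b : Fin 2) {G : Ω → ℝ≥0∞} (hG : Measurable[S.sigmaFuture t] G) :
    ∫⁻ ω, {ω | S.A t ω = b}.indicator G ω ∂μ =
      ∫⁻ ω, ENNReal.ofReal (S.propensity μ t b (S.H t ω)) * G ω ∂μ :=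
  (hSR t ht).lintegral_indicator_eq (S.measurable_UA t) (S.measurable_futureExogenous t)
    (S.measurable_H t) (E := {x | S.fA t x.1 x.2 = b})
    (S.measurable_fA t (measurableSet_singleton b))
    (S.measurable_propensity μ t b).ennreal_ofReal (S.map_restrict_treat μ t b) hG

variable {a : ℕ → Fin 2} {f : ∀ t : ℕ, Hist d t → ℝ}

/-- Reweighting: on the event `A_t = b` the weight turns the propensity score into the intervention
propensity score. -/
theorem StrongSequentialRandomization.lintegral_weight (hSR : S.StrongSequentialRandomization μ)
    {t : ℕ} (ht : t < T) (hf : Measurable (f t))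
    (hpos : ∀ᵐ ω ∂μ, S.propensity μ t (a t) (S.H t ω) = 0 → f t (S.H t ω) = 0) (b : Fin 2)
    {G : Ω → ℝ≥0∞} (hG : Measurable[S.sigmaFuture t] G) :
    ∫⁻ ω, {ω | S.A t ω = b}.indicator (fun ω => S.weight μ a f t b (S.H t ω) * G ω) ω ∂μ =
      ∫⁻ ω, ENNReal.ofReal (S.Q μ a f t b (S.H t ω)) * G ω ∂μ := by
  have hm : Measurable[S.sigmaFuture t] fun ω => S.weight μ a f t b (S.H t ω) * G ω :=
    ((S.measurable_weight μ a f hf b).comp (S.measurable_sigmaFuture_H t)).mul hG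
  rw [hSR.lintegral_treat ht b hm]
  refine lintegral_congr_ae (hpos.mono fun ω hω => ?_)
  beta_reduce
  rw [← mul_assoc, S.propensity_mul_weight μ a f hω]

/-- The chance that the flip intervention at `t` assigns `b`, given the history `h` and the natural
value `n` of treatment. -/
noncomputable def flipProb (a : ℕ → Fin 2) (f : ∀ t : ℕ, Hist d t → ℝ) (t : ℕ) (b : Fin 2)
    (h : Hist d t) (n : Fin 2) : ℝ≥0∞ :=
  if n = a t then (if b = a t then 1 else 0)
  else if b = a t then ENNReal.ofReal (f t h) else ENNReal.ofReal (1 - f t h)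

theorem measurable_flipProb {t : ℕ} (hf : Measurable (f t)) (b : Fin 2) :
    Measurable fun p : Hist d t × Fin 2 => flipProb a f t b p.1 p.2 := by
  refine measurable_from_prod_countable_left fun n => ?_
  have h1 : Measurable fun h => ENNReal.ofReal (1 - f t h) :=
    (measurable_const.sub hf).ennreal_ofReal
  by_cases hn : n = a t <;> by_cases hb : b = a t
  · simp [flipProb, hn, hb]
  · simp [flipProb, hn, hb]
  · simpa [flipProb, hn, hb] using hf.ennreal_ofReal
  · simpa [flipProb, hn, hb] using h1

/-- Averaging the flip over the natural value of treatment gives the intervention propensity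
score. -/
theorem sum_propensity_mul_flipProb (S : NPSEM Ω d T EX EA EY) (μ : Measure Ω) [IsFiniteMeasure μ]
    {t : ℕ} {h : Hist d t} (hf : f t h ∈ Set.Icc (0 : ℝ) 1) (b : Fin 2) :
    ∑ n, ENNReal.ofReal (S.propensity μ t n h) * flipProb a f t b h n =
      ENNReal.ofReal (S.Q μ a f t b h) := by
  obtain ⟨c, hc, hu⟩ : ∃ c, c ≠ a t ∧ (Finset.univ : Finset (Fin 2)) = {a t, c} := by
    generalize a t = e
    fin_cases e
    · exact ⟨1, by decide, by decide⟩
    · exact ⟨0, by decide, by decide⟩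
  have h0 := S.propensity_nonneg μ t c h
  have h1 := S.propensity_nonneg μ t (a t) h
  have hpc := S.propensity_eq_one_sub μ t hc h
  rw [hu, Finset.sum_pair hc.symm]
  simp only [flipProb, if_neg hc, if_pos]
  unfold Q
  split_ifs with hb
  · rw [mul_one, ← ENNReal.ofReal_mul h0, ← ENNReal.ofReal_add h1 (mul_nonneg h0 hf.1), hpc,
      mul_comm (1 - _)]
  · rw [mul_zero, zero_add, ← ENNReal.ofReal_mul h0, hpc]
    congr 1
    ring

/-- The step that exchanges, at one timepoint, the flip probability for the weighted indicator
of the observed treatment. -/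
theorem StrongSequentialRandomization.lintegral_flipProb (hSR : S.StrongSequentialRandomization μ)
    {t : ℕ} (ht : t < T) (hf : Measurable (f t)) (hf01 : ∀ h, f t h ∈ Set.Icc (0 : ℝ) 1)
    (hpos : ∀ᵐ ω ∂μ, S.propensity μ t (a t) (S.H t ω) = 0 → f t (S.H t ω) = 0) (b : Fin 2)
    {G : Ω → ℝ≥0∞} (hG : Measurable[S.sigmaFuture t] G) :
    ∫⁻ ω, flipProb a f t b (S.H t ω) (S.A t ω) * G ω ∂μ =
      ∫⁻ ω, {ω | S.A t ω = b}.indicator (fun ω => S.weight μ a f t b (S.H t ω) * G ω) ω ∂μ := by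
  have hm (n : Fin 2) :
      Measurable[S.sigmaFuture t] fun ω => flipProb a f t b (S.H t ω) n * G ω :=
    ((measurable_flipProb hf b).comp
      ((S.measurable_sigmaFuture_H t).prodMk measurable_const)).mul hG
  have hp (n : Fin 2) : Measurable fun ω => ENNReal.ofReal (S.propensity μ t n (S.H t ω)) :=
    ((S.measurable_propensity μ t n).comp (S.measurable_H t)).ennreal_ofReal
  rw [hSR.lintegral_weight ht hf hpos b hG,
    S.lintegral_eq_sum_treat μ (G := fun n ω => flipProb a f t b (S.H t ω) n * G ω)
      fun n => (hm n).mono (S.sigmaFuture_le t) le_rfl]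
  simp_rw [fun n => hSR.lintegral_treat ht n (hm n)]
  have hpm (n : Fin 2) : Measurable fun ω => ENNReal.ofReal (S.propensity μ t n (S.H t ω)) *
      (flipProb a f t b (S.H t ω) n * G ω) :=
    (hp n).mul ((hm n).mono (S.sigmaFuture_le t) le_rfl)
  rw [← lintegral_finsetSum _ fun n _ => hpm n]
  refine lintegral_congr fun ω => ?_
  simp_rw [← mul_assoc]
  rw [← Finset.sum_mul, S.sum_propensity_mul_flipProb μ (hf01 _)]

end Randomization

/-! ### Static interventions from a timepoint on -/

/-- The intervention that leaves the treatments before timepoint `k` at their natural values and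
sets the later ones to `b`. -/
def staticFrom (Ω : Type*) (d k : ℕ) {T : ℕ} (b : Fin T → Fin 2) : Regime Ω d :=
  fun t ω h n => if t < k then n else static Ω d b t ω h n

theorem staticFrom_zero (Ω : Type*) (d : ℕ) {T : ℕ} (b : Fin T → Fin 2) : staticFrom Ω d 0 b = static Ω d b := by
  funext t ω h n
  simp [staticFrom]

theorem pastUnder_staticFrom (S : NPSEM Ω d T EX EA EY) (b : Fin T → Fin 2) {k t : ℕ}
    (ht : t ≤ k) (ω : Ω) : S.pastUnder (staticFrom Ω d k b) t ω = S.past t ω := by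
  refine (S.pastUnder_congr fun s hs => ?_).symm
  rw [staticFrom, if_pos (hs.trans_le ht)]
  rfl

theorem histUnder_staticFrom (S : NPSEM Ω d T EX EA EY) (b : Fin T → Fin 2) {k t : ℕ}
    (ht : t ≤ k) (ω : Ω) : S.histUnder (staticFrom Ω d k b) t ω = S.H t ω :=
  S.histUnder_congr (S.pastUnder_staticFrom b ht ω)

theorem naturalUnder_staticFrom (S : NPSEM Ω d T EX EA EY) (b : Fin T → Fin 2) {k t : ℕ}
    (ht : t ≤ k) (ω : Ω) : S.naturalUnder (staticFrom Ω d k b) t ω = S.A t ω := by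
  rw [naturalUnder, S.histUnder_staticFrom b ht]
  rfl

/-- If the observed treatment at timepoint `k` is `b k`, setting it to `b k` changes nothing. -/
theorem pastUnder_staticFrom_succ (S : NPSEM Ω d T EX EA EY) (b : Fin T → Fin 2) (k : Fin T)
    {ω : Ω} (h : S.A k ω = b k) (t : ℕ) :
    S.pastUnder (staticFrom Ω d k b) t ω = S.pastUnder (staticFrom Ω d (k + 1) b) t ω := by
  refine S.pastUnder_congr fun s _ => ?_
  unfold treatUnder
  rcases lt_trichotomy s k with hs | hs | hs
  · rw [staticFrom, staticFrom, if_pos hs, if_pos (hs.trans k.val.lt_succ_self)]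
  · subst hs
    rw [staticFrom, staticFrom, if_neg (lt_irrefl _), if_pos k.val.lt_succ_self,
      S.naturalUnder_staticFrom b le_rfl, h]
    simp [static]
  · rw [staticFrom, staticFrom, if_neg hs.not_gt, if_neg (by omega)]

theorem treatUnder_staticFrom (S : NPSEM Ω d T EX EA EY) (b : Fin T → Fin 2) {k t : ℕ}
    (hk : k ≤ t) (ht : t < T) (ω : Ω) :
    S.treatUnder (staticFrom Ω d k b) t ω = b ⟨t, ht⟩ := by
  simp [treatUnder, staticFrom, static, hk.not_gt, ht]

/-- After timepoint `k` the variables under `staticFrom k b` are functions of the observed history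
at `k` and the later exogenous variables. -/
theorem measurable_sigmaFuture_pastUnder (S : NPSEM Ω d T EX EA EY) (b : Fin T → Fin 2) {k t : ℕ}
    (hkt : k + 1 ≤ t) (ht : t ≤ T) :
    Measurable[S.sigmaFuture k] (S.pastUnder (staticFrom Ω d k b) t) := by
  induction t, hkt using Nat.le_induction with
  | base =>
    have he : S.pastUnder (staticFrom Ω d k b) (k + 1) = fun ω => ((S.H k ω).1,
        Fin.snoc (α := fun _ => Fin 2) (S.H k ω).2 (b ⟨k, ht⟩)) := by
      funext ω
      rw [pastUnder_succ, S.histUnder_staticFrom b le_rfl, S.treatUnder_staticFrom b le_rfl ht,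
        S.pastUnder_staticFrom b le_rfl]
      rfl
    rw [he]
    have hH := S.measurable_sigmaFuture_H k
    exact (measurable_fst.comp hH).prodMk ((measurable_snd.comp hH).finSnoc measurable_const)
  | succ t hkt ih =>
    have ih := ih (t.le_succ.trans ht)
    have hUX : Measurable[S.sigmaFuture k] (S.UX t) :=
      (measurable_pi_apply (⟨t, hkt, ht⟩ : Set.Ioo k T)).comp
        (measurable_fst.comp (S.measurable_sigmaFuture_futureExogenous k))
    have he : S.pastUnder (staticFrom Ω d k b) (t + 1) = fun ω =>
        (Fin.snoc (α := fun _ => Cov d) (S.pastUnder (staticFrom Ω d k b) t ω).1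
            (S.fX t (S.pastUnder (staticFrom Ω d k b) t ω) (S.UX t ω)),
          Fin.snoc (α := fun _ => Fin 2) (S.pastUnder (staticFrom Ω d k b) t ω).2
            (b ⟨t, ht⟩)) := by
      funext ω
      rw [pastUnder_succ, S.treatUnder_staticFrom b (k.le_succ.trans hkt) ht]
      rfl
    rw [he]
    exact ((measurable_fst.comp ih).finSnoc ((S.measurable_fX t).comp (ih.prodMk hUX))).prodMk
      ((measurable_snd.comp ih).finSnoc measurable_const)

theorem measurable_sigmaFuture_histUnder (S : NPSEM Ω d T EX EA EY) (b : Fin T → Fin 2) {k t : ℕ}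
    (hkt : k < t) (ht : t < T) :
    Measurable[S.sigmaFuture k] (S.histUnder (staticFrom Ω d k b) t) := by
  have hp := S.measurable_sigmaFuture_pastUnder b hkt ht.le
  have hUX : Measurable[S.sigmaFuture k] (S.UX t) :=
    (measurable_pi_apply (⟨t, hkt, ht⟩ : Set.Ioo k T)).comp
      (measurable_fst.comp (S.measurable_sigmaFuture_futureExogenous k))
  exact ((measurable_fst.comp hp).finSnoc ((S.measurable_fX t).comp (hp.prodMk hUX))).prodMk
    (measurable_snd.comp hp)

theorem measurable_sigmaFuture_naturalUnder (S : NPSEM Ω d T EX EA EY) (b : Fin T → Fin 2)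
    {k t : ℕ} (hkt : k < t) (ht : t < T) :
    Measurable[S.sigmaFuture k] (S.naturalUnder (staticFrom Ω d k b) t) := by
  have hUA : Measurable[S.sigmaFuture k] (S.UA t) :=
    (measurable_pi_apply (⟨t, hkt, ht⟩ : Set.Ioo k T)).comp
      (measurable_fst.comp (measurable_snd.comp (S.measurable_sigmaFuture_futureExogenous k)))
  exact (S.measurable_fA t).comp ((S.measurable_sigmaFuture_histUnder b hkt ht).prodMk hUA)

theorem measurable_sigmaFuture_UY (S : NPSEM Ω d T EX EA EY) (k : ℕ) :
    Measurable[S.sigmaFuture k] S.UY :=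
  measurable_snd.comp (measurable_snd.comp (S.measurable_sigmaFuture_futureExogenous k))

theorem measurable_sigmaFuture_A (S : NPSEM Ω d T EX EA EY) {k t : ℕ} (ht : t < k) :
    Measurable[S.sigmaFuture k] (S.A t) := by
  have he : S.A t = fun ω => (S.H k ω).2 ⟨t, ht⟩ := by
    funext ω
    unfold A H
    rw [histUnder_eq]
  rw [he]
  exact (measurable_pi_apply _).comp (measurable_snd.comp (S.measurable_sigmaFuture_H k))

theorem measurable_sigmaFuture_H_of_lt (S : NPSEM Ω d T EX EA EY) {k t : ℕ} (ht : t < k) :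
    Measurable[S.sigmaFuture k] (S.H t) := by
  have he : S.H t = fun ω => (fun i : Fin (t + 1) => (S.H k ω).1 (i.castLE (by omega)),
      fun i : Fin t => (S.H k ω).2 (i.castLE ht.le)) := by
    funext ω
    unfold H
    rw [histUnder_eq, histUnder_eq]
    rfl
  have hcut : Measurable fun h : Hist d k => ((fun i : Fin (t + 1) => h.1 (i.castLE (by omega)),
      fun i : Fin t => h.2 (i.castLE ht.le)) : Hist d t) :=
    (measurable_pi_iff.2 fun i => (measurable_pi_apply _).comp measurable_fst).prodMk
      (measurable_pi_iff.2 fun i => (measurable_pi_apply _).comp measurable_snd)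
  rw [he]
  exact hcut.comp (S.measurable_sigmaFuture_H k)

/-! ### Exchanging flips for weights, one timepoint at a time -/

section Hybrid

variable (S : NPSEM Ω d T EX EA EY) (μ : Measure Ω) [IsFiniteMeasure μ] (a : ℕ → Fin 2)
  (f : ∀ t : ℕ, Hist d t → ℝ)

/-- The factor of timepoint `s` when the first `k` timepoints have been treated: the weighted
indicator of the observed treatment for `s < k`, and for `k ≤ s` the flip probability in the world
in which treatment is set to `b` from `k` on. -/
noncomputable def hybridFactor (k : ℕ) (b : Fin T → Fin 2) (s : Fin T) (ω : Ω) : ℝ≥0∞ :=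
  if (s : ℕ) < k then {ω | S.A s ω = b s}.indicator (fun ω => S.weight μ a f s (b s) (S.H s ω)) ω
  else flipProb a f s (b s) (S.histUnder (staticFrom Ω d k b) s ω)
    (S.naturalUnder (staticFrom Ω d k b) s ω)

/-- The integrand between the flip world (`k = 0`) and the observed world (`k = T`). -/
noncomputable def hybrid (R : Past d T → EY → ℝ≥0∞) (k : ℕ) (b : Fin T → Fin 2) (ω : Ω) : ℝ≥0∞ :=
  R (S.pastUnder (staticFrom Ω d k b) T ω) (S.UY ω) * ∏ s, S.hybridFactor μ a f k b s ω

variable {S μ a f}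

theorem measurable_sigmaFuture_hybridFactor (hf : ∀ t < T, Measurable (f t)) (b : Fin T → Fin 2)
    {k s : Fin T} (hs : s ≠ k) :
    Measurable[S.sigmaFuture k] (S.hybridFactor μ a f k b s) := by
  unfold hybridFactor
  split_ifs with hsk
  · exact ((S.measurable_weight μ a f (hf s s.isLt) (b s)).comp
      (S.measurable_sigmaFuture_H_of_lt hsk)).indicator
      (S.measurable_sigmaFuture_A hsk (measurableSet_singleton (b s)))
  · have hks : (k : ℕ) < s := lt_of_le_of_ne (not_lt.1 hsk) fun h => hs (Fin.ext h.symm)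
    exact (measurable_flipProb (hf s s.isLt) (b s)).comp
      ((S.measurable_sigmaFuture_histUnder b hks s.isLt).prodMk
        (S.measurable_sigmaFuture_naturalUnder b hks s.isLt))

/-- One exchange: the factors of the other timepoints are functions of the history at `k` and of later
exogenous variables, so strong sequential randomization applies to the factor of `k`. -/
theorem lintegral_hybrid_succ (hSR : S.StrongSequentialRandomization μ)
    (hf : ∀ t < T, Measurable (f t)) (hf01 : ∀ t < T, ∀ h, f t h ∈ Set.Icc (0 : ℝ) 1)
    (hpos : ∀ t < T, ∀ᵐ ω ∂μ, S.propensity μ t (a t) (S.H t ω) = 0 → f t (S.H t ω) = 0)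
    {R : Past d T → EY → ℝ≥0∞} (hR : Measurable (Function.uncurry R)) (b : Fin T → Fin 2)
    (k : Fin T) :
    ∫⁻ ω, S.hybrid μ a f R k b ω ∂μ = ∫⁻ ω, S.hybrid μ a f R (k + 1) b ω ∂μ := by
  set G : Ω → ℝ≥0∞ := fun ω => R (S.pastUnder (staticFrom Ω d k b) T ω) (S.UY ω) *
    ∏ s ∈ Finset.univ.erase k, S.hybridFactor μ a f k b s ω with hGdef
  have hG : Measurable[S.sigmaFuture k] G :=
    (hR.comp ((S.measurable_sigmaFuture_pastUnder b k.isLt le_rfl).prodMk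
      (S.measurable_sigmaFuture_UY k))).mul (Finset.measurable_prod _ fun s hs =>
        measurable_sigmaFuture_hybridFactor hf b (Finset.ne_of_mem_erase hs))
  have h1 (ω : Ω) : S.hybrid μ a f R k b ω =
      flipProb a f k (b k) (S.H k ω) (S.A k ω) * G ω := by
    have hk : S.hybridFactor μ a f k b k ω = flipProb a f k (b k) (S.H k ω) (S.A k ω) := by
      rw [hybridFactor, if_neg (lt_irrefl _), S.histUnder_staticFrom b le_rfl,
        S.naturalUnder_staticFrom b le_rfl]
    rw [hybrid, ← Finset.mul_prod_erase _ _ (Finset.mem_univ k), hk, hGdef]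
    ring
  have h2 (ω : Ω) : S.hybrid μ a f R (k + 1) b ω =
      {ω | S.A k ω = b k}.indicator (fun ω => S.weight μ a f k (b k) (S.H k ω) * G ω) ω := by
    have hk : S.hybridFactor μ a f (k + 1) b k ω =
        {ω | S.A k ω = b k}.indicator (fun ω => S.weight μ a f k (b k) (S.H k ω)) ω := by
      rw [hybridFactor, if_pos k.val.lt_succ_self]
    rw [hybrid, ← Finset.mul_prod_erase _ _ (Finset.mem_univ k), hk]
    -- off the event `A_k = b_k` both sides vanish; on it, the two hybrid worlds coincide
    by_cases hA : S.A k ω = b k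
    · rw [Set.indicator_of_mem (by exact hA), Set.indicator_of_mem (by exact hA), hGdef,
        ← S.pastUnder_staticFrom_succ b k hA]
      have hs : ∏ s ∈ Finset.univ.erase k, S.hybridFactor μ a f (k + 1) b s ω =
          ∏ s ∈ Finset.univ.erase k, S.hybridFactor μ a f k b s ω := by
        refine Finset.prod_congr rfl fun s hs => ?_
        have hne : (s : ℕ) ≠ k := fun h => Finset.ne_of_mem_erase hs (Fin.ext h)
        have hiff : (s : ℕ) < k + 1 ↔ (s : ℕ) < k := by omega
        simp only [hybridFactor, hiff, naturalUnder,
          S.histUnder_congr (S.pastUnder_staticFrom_succ b k hA s)]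
      rw [hs]
      ring
    · rw [Set.indicator_of_notMem (by exact hA), Set.indicator_of_notMem (by exact hA)]
      simp
  simp_rw [h1, h2]
  exact hSR.lintegral_flipProb k.isLt (hf k k.isLt) (hf01 k k.isLt) (hpos k k.isLt) (b k) hG

theorem lintegral_hybrid (hSR : S.StrongSequentialRandomization μ)
    (hf : ∀ t < T, Measurable (f t)) (hf01 : ∀ t < T, ∀ h, f t h ∈ Set.Icc (0 : ℝ) 1)
    (hpos : ∀ t < T, ∀ᵐ ω ∂μ, S.propensity μ t (a t) (S.H t ω) = 0 → f t (S.H t ω) = 0)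
    {R : Past d T → EY → ℝ≥0∞} (hR : Measurable (Function.uncurry R)) (b : Fin T → Fin 2) {k : ℕ}
    (hk : k ≤ T) :
    ∫⁻ ω, S.hybrid μ a f R 0 b ω ∂μ = ∫⁻ ω, S.hybrid μ a f R k b ω ∂μ := by
  induction k with
  | zero => rfl
  | succ k ih =>
    rw [ih (k.le_succ.trans hk)]
    exact lintegral_hybrid_succ hSR hf hf01 hpos hR b ⟨k, hk⟩

/-- At `k = T` the sum over all treatment paths collapses to the observed one. -/
theorem sum_hybrid (hf01 : ∀ t < T, ∀ h, f t h ∈ Set.Icc (0 : ℝ) 1) (R : Past d T → EY → ℝ≥0∞)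
    (ω : Ω) : ∑ b, S.hybrid μ a f R T b ω =
      R (S.past T ω) (S.UY ω) * ENNReal.ofReal (S.ipw μ a f T ω) := by
  simp only [hybrid, hybridFactor, S.pastUnder_staticFrom _ le_rfl, Fin.is_lt, if_true]
  rw [← Finset.mul_sum, S.ofReal_ipw μ a f hf01,
    ← Fin.prod_univ_eq_prod_range (fun s => S.weight μ a f s (S.A s ω) (S.H s ω)) T]
  congr 1
  have h := Fintype.prod_sum fun (s : Fin T) (c : Fin 2) =>
    {ω | S.A s ω = c}.indicator (fun ω => S.weight μ a f s c (S.H s ω)) ω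
  rw [← h]
  refine Finset.prod_congr rfl fun s _ => ?_
  simp [Set.indicator_apply]

end Hybrid

/-! ### Integrating out the auxiliary uniform variables -/

theorem measure_uniform_le {μ : Measure Ω} {U : Ω → ℝ}
    (hU : pdf.IsUniform U (Set.Icc (0 : ℝ) 1) μ volume) {c : ℝ} (hc : c ∈ Set.Icc (0 : ℝ) 1) :
    μ {ω | U ω ≤ c} = ENNReal.ofReal c := by
  have h := hU.measure_preimage (by simp) (by simp) (measurableSet_Iic (a := c))
  have hi : Set.Icc (0 : ℝ) 1 ∩ Set.Iic c = Set.Icc 0 c := by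
    ext x
    simp only [Set.mem_inter_iff, Set.mem_Icc, Set.mem_Iic]
    have := hc.2
    constructor
    · rintro ⟨⟨h1, -⟩, h2⟩
      exact ⟨h1, h2⟩
    · rintro ⟨h1, h2⟩
      exact ⟨⟨h1, h2.trans this⟩, h2⟩
  have he : {ω | U ω ≤ c} = U ⁻¹' Set.Iic c := rfl
  rw [he, h, hi]
  simp

/-- The value assigned by the flip intervention at history `h`, natural value `n` of treatment and
value `v` of the auxiliary variable. -/
noncomputable def flipValue (a : ℕ → Fin 2) (f : ∀ t : ℕ, Hist d t → ℝ) (t : ℕ) (h : Hist d t)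
    (n : Fin 2) (v : ℝ) : Fin 2 :=
  if n = a t then n else if v ≤ f t h then a t else n

theorem lintegral_flipValue {μ : Measure Ω} [IsProbabilityMeasure μ] {a : ℕ → Fin 2}
    {f : ∀ t : ℕ, Hist d t → ℝ} {t : ℕ} {U : Ω → ℝ} (hUm : Measurable U)
    (hU : pdf.IsUniform U (Set.Icc (0 : ℝ) 1) μ volume) {h : Hist d t}
    (hf : f t h ∈ Set.Icc (0 : ℝ) 1) (n b : Fin 2) :
    ∫⁻ ω, (if flipValue a f t h n (U ω) = b then 1 else 0) ∂μ = flipProb a f t b h n := by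
  have hm : MeasurableSet {ω | U ω ≤ f t h} := hUm measurableSet_Iic
  have h1 := measure_uniform_le hU hf
  have h2 : μ {ω | U ω ≤ f t h}ᶜ = ENNReal.ofReal (1 - f t h) := by
    rw [prob_compl_eq_one_sub hm, h1, ENNReal.ofReal_sub _ hf.1, ENNReal.ofReal_one]
  unfold flipValue flipProb
  by_cases hn : n = a t
  · by_cases hb : b = a t
    · simp [hn, hb]
    · simp [hn, hb, Ne.symm hb]
  · simp only [if_neg hn]
    by_cases hb : b = a t
    · rw [if_pos hb, ← h1, ← lintegral_indicator_one hm]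
      refine lintegral_congr fun ω => ?_
      by_cases hω : U ω ≤ f t h <;> simp [hω, hb, hn]
    · have hnb : n = b := by
        generalize a t = e at hn hb
        fin_cases n <;> fin_cases b <;> fin_cases e <;> simp_all
      rw [if_neg hb, ← h2, ← lintegral_indicator_one hm.compl]
      refine lintegral_congr fun ω => ?_
      by_cases hω : U ω ≤ f t h <;> simp [hω, hnb, Ne.symm hb]

section Flip

variable {S : NPSEM Ω d T EX EA EY} {μ : Measure Ω} [IsProbabilityMeasure μ] {a : ℕ → Fin 2}
  {f : ∀ t : ℕ, Hist d t → ℝ} {V : ℕ → Ω → ℝ}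

/-- For fixed potential variables, the flips along a treatment path are independent. -/
theorem lintegral_prod_flipValue
    (hf : ∀ t < T, Measurable (f t)) (hf01 : ∀ t < T, ∀ h, f t h ∈ Set.Icc (0 : ℝ) 1)
    (hV : ∀ t < T, Measurable (V t))
    (hV_unif : ∀ t < T, pdf.IsUniform (V t) (Set.Icc (0 : ℝ) 1) μ volume)
    (hV_indep : iIndepFun (fun (t : Fin T) => V t) μ)
    (hV_pot : IndepFun (fun ω (t : Fin T) => V t ω) S.potentials μ)
    {F : ((Fin T → Fin 2) → (Fin T → Cov d) × (Fin T → Fin 2) × ℝ) → ℝ≥0∞} (hF : Measurable F)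
    (b : Fin T → Fin 2) :
    ∫⁻ ω, F (S.potentials ω) * ∏ s : Fin T, (if flipValue a f s
        (S.histUnder (static Ω d b) s ω) (S.naturalUnder (static Ω d b) s ω) (V s ω) = b s
          then 1 else 0) ∂μ =
      ∫⁻ ω, F (S.potentials ω) * ∏ s : Fin T, flipProb a f s (b s)
        (S.histUnder (static Ω d b) s ω) (S.naturalUnder (static Ω d b) s ω) ∂μ := by
  have hVm : Measurable fun ω (t : Fin T) => V t ω := measurable_pi_iff.2 fun t => hV t t.isLt
  have hPm := S.measurable_potentials
  set g : Fin T → ((Fin T → Fin 2) → (Fin T → Cov d) × (Fin T → Fin 2) × ℝ) → ℝ → ℝ≥0∞ :=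
    fun s p v => if flipValue a f s (cutHist (p b).1 b s) ((p b).2.1 s) v = b s then 1 else 0
    with hg
  have hh (s : Fin T) : Measurable
      fun p : (Fin T → Fin 2) → (Fin T → Cov d) × (Fin T → Fin 2) × ℝ => cutHist (p b).1 b s :=
    (measurable_cutHist b s).comp (measurable_pi_apply b).fst
  have hn (s : Fin T) : Measurable
      fun p : (Fin T → Fin 2) → (Fin T → Cov d) × (Fin T → Fin 2) × ℝ => (p b).2.1 s :=
    (measurable_pi_apply s).comp (measurable_pi_apply b).snd.fst
  have hgm (s : Fin T) : Measurable (Function.uncurry (g s)) := by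
    have hfs := (hf s s.isLt).comp (hh s)
    have hval : Measurable fun q : ((Fin T → Fin 2) → (Fin T → Cov d) × (Fin T → Fin 2) × ℝ) × ℝ =>
        flipValue a f s (cutHist (q.1 b).1 b s) ((q.1 b).2.1 s) q.2 := by
      unfold flipValue
      refine Measurable.ite (((hn s).comp measurable_fst) (measurableSet_singleton (a s)))
        ((hn s).comp measurable_fst) (Measurable.ite ?_ measurable_const
          ((hn s).comp measurable_fst))
      exact measurableSet_le measurable_snd (hfs.comp measurable_fst)
    exact Measurable.ite (hval (measurableSet_singleton (b s))) measurable_const measurable_const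
  have hinner (p : (Fin T → Fin 2) → (Fin T → Cov d) × (Fin T → Fin 2) × ℝ) :
      ∫⁻ ω, ∏ s : Fin T, g s p (V s ω) ∂μ =
        ∏ s : Fin T, flipProb a f s (b s) (cutHist (p b).1 b s) ((p b).2.1 s) := by
    have hgp (s : Fin T) : Measurable (g s p) := (hgm s).comp (measurable_const.prodMk measurable_id)
    rw [lintegral_prod_eq_prod_lintegral_of_indepFun Finset.univ
      (fun (s : Fin T) ω => g s p (V s ω)) (hV_indep.comp _ hgp)
      fun s => (hgp s).comp (hV s s.isLt)]
    exact Finset.prod_congr rfl fun s _ =>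
      lintegral_flipValue (hV s s.isLt) (hV_unif s s.isLt) (hf01 s s.isLt _) _ _
  have hlaw := (indepFun_iff_map_prod_eq_prod_map_map hPm.aemeasurable hVm.aemeasurable).1
    hV_pot.symm
  have hprod : Measurable fun q : ((Fin T → Fin 2) → (Fin T → Cov d) × (Fin T → Fin 2) × ℝ) ×
      (Fin T → ℝ) => ∏ s : Fin T, g s q.1 (q.2 s) :=
    Finset.measurable_prod _ fun s _ => (hgm s).comp
      (measurable_fst.prodMk ((measurable_pi_apply s).comp measurable_snd))
  have hint : Measurable fun q : ((Fin T → Fin 2) → (Fin T → Cov d) × (Fin T → Fin 2) × ℝ) ×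
      (Fin T → ℝ) => F q.1 * ∏ s : Fin T, g s q.1 (q.2 s) := (hF.comp measurable_fst).mul hprod
  simp_rw [S.histUnder_static b]
  calc ∫⁻ ω, F (S.potentials ω) * ∏ s : Fin T, g s (S.potentials ω) (V s ω) ∂μ
      = ∫⁻ q, F q.1 * ∏ s : Fin T, g s q.1 (q.2 s)
          ∂(μ.map fun ω => (S.potentials ω, fun t : Fin T => V t ω)) :=
        (lintegral_map hint (hPm.prodMk hVm)).symm
    _ = ∫⁻ p, F p * ∏ s : Fin T, flipProb a f s (b s) (cutHist (p b).1 b s) ((p b).2.1 s)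
          ∂(μ.map S.potentials) := by
        have : IsProbabilityMeasure (μ.map fun ω (t : Fin T) => V t ω) :=
          Measure.isProbabilityMeasure_map hVm.aemeasurable
        rw [hlaw, lintegral_prod _ hint.aemeasurable]
        refine lintegral_congr fun p => ?_
        have hpm : Measurable fun v : Fin T → ℝ => ∏ s : Fin T, g s p (v s) :=
          hprod.comp (measurable_const.prodMk measurable_id)
        dsimp only
        rw [lintegral_const_mul _ hpm, lintegral_map hpm hVm, hinner]
    _ = _ := by
        refine lintegral_map (hF.mul (Finset.measurable_prod _ fun s _ => ?_)) hPm
        exact (measurable_flipProb (hf s s.isLt) (b s)).comp ((hh s).prodMk (hn s))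

/-- The flip world is pieced together from the static worlds: exactly one treatment path is
reproduced by the flips made along it, and it is the path assigned by the flip intervention. -/
theorem apply_flip_eq_sum (S : NPSEM Ω d T EX EA EY) (a : ℕ → Fin 2) (f : ∀ t : ℕ, Hist d t → ℝ)
    (V : ℕ → Ω → ℝ) (R : Past d T → ℝ → ℝ≥0∞) (ω : Ω) :
    R (S.pastUnder (flip a f V) T ω) (S.outcomeUnder (flip a f V) ω) =
      ∑ b : Fin T → Fin 2, R (S.pastUnder (static Ω d b) T ω) (S.outcomeUnder (static Ω d b) ω) *
        ∏ s : Fin T, (if flipValue a f s (S.histUnder (static Ω d b) s ω)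
          (S.naturalUnder (static Ω d b) s ω) (V s ω) = b s then 1 else 0) := by
  set D : Fin T → Fin 2 := fun s => S.treatUnder (flip a f V) s ω with hD
  have hpast : ∀ t ≤ T, S.pastUnder (flip a f V) t ω = S.pastUnder (static Ω d D) t ω := by
    intro t ht
    refine S.pastUnder_congr fun s hs => ?_
    simp [static, hs.trans_le ht, hD]
  rw [Finset.sum_eq_single D]
  · rw [Finset.prod_eq_one, mul_one, outcomeUnder, outcomeUnder, hpast T le_rfl]
    intro s _
    rw [naturalUnder, ← S.histUnder_congr (hpast s s.isLt.le)]
    exact if_pos rfl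
  · intro b _ hb
    obtain ⟨s, hs⟩ : ∃ s : Fin T, flipValue a f s (S.histUnder (static Ω d b) s ω)
        (S.naturalUnder (static Ω d b) s ω) (V s ω) ≠ b s := by
      by_contra! hall
      refine hb (funext fun s => ?_)
      have hp : S.pastUnder (static Ω d b) s ω = S.pastUnder (flip a f V) s ω := by
        refine S.pastUnder_congr fun r hr => ?_
        rw [S.treatUnder_static b ⟨r, hr.trans s.isLt⟩, ← hall ⟨r, hr.trans s.isLt⟩]
        rfl
      rw [← hall s, naturalUnder, S.histUnder_congr hp]
      rfl
    rw [Finset.prod_eq_zero (Finset.mem_univ s) (if_neg hs), mul_zero]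
  · exact fun h => absurd (Finset.mem_univ _) h

/-- The joint law of the flip world is the observed law reweighted by the inverse probability
weight. -/
theorem lintegral_flip (hSR : S.StrongSequentialRandomization μ)
    (hf : ∀ t < T, Measurable (f t)) (hf01 : ∀ t < T, ∀ h, f t h ∈ Set.Icc (0 : ℝ) 1)
    (hV : ∀ t < T, Measurable (V t))
    (hV_unif : ∀ t < T, pdf.IsUniform (V t) (Set.Icc (0 : ℝ) 1) μ volume)
    (hV_indep : iIndepFun (fun (t : Fin T) => V t) μ)
    (hV_pot : IndepFun (fun ω (t : Fin T) => V t ω) S.potentials μ)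
    (hpos : ∀ t < T, ∀ᵐ ω ∂μ, S.propensity μ t (a t) (S.H t ω) = 0 → f t (S.H t ω) = 0)
    {R : Past d T → ℝ → ℝ≥0∞} (hR : Measurable (Function.uncurry R)) :
    ∫⁻ ω, R (S.pastUnder (flip a f V) T ω) (S.outcomeUnder (flip a f V) ω) ∂μ =
      ∫⁻ ω, ENNReal.ofReal (S.ipw μ a f T ω) * R (S.past T ω) (S.Y ω) ∂μ := by
  have hstat (b : Fin T → Fin 2) (t : ℕ) : Measurable (S.pastUnder (static Ω d b) t) :=
    S.measurable_pastUnder fun s _ => regimeMeasurable_static b s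
  have hRs (b : Fin T → Fin 2) : Measurable fun ω =>
      R (S.pastUnder (static Ω d b) T ω) (S.outcomeUnder (static Ω d b) ω) :=
    hR.comp ((hstat b T).prodMk (S.measurable_outcomeUnder fun s _ => regimeMeasurable_static b s))
  have hflip (b : Fin T → Fin 2) (s : Fin T) : Measurable fun ω =>
      flipValue a f s (S.histUnder (static Ω d b) s ω) (S.naturalUnder (static Ω d b) s ω)
        (V s ω) :=
    (regimeMeasurable_flip (a := a) (hf s s.isLt) (hV s s.isLt)).comp (measurable_id.prodMk
      ((S.measurable_histUnder_of_pastUnder (hstat b s)).prodMk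
        (S.measurable_naturalUnder_of_pastUnder (hstat b s))))
  set R' : Past d T → EY → ℝ≥0∞ := fun p u => R p (S.fY p u) with hR'
  have hR'm : Measurable (Function.uncurry R') :=
    hR.comp (measurable_fst.prodMk S.measurable_fY)
  have hterm (b : Fin T → Fin 2) : ∫⁻ ω, R (S.pastUnder (static Ω d b) T ω)
      (S.outcomeUnder (static Ω d b) ω) * ∏ s : Fin T, (if flipValue a f s
        (S.histUnder (static Ω d b) s ω) (S.naturalUnder (static Ω d b) s ω) (V s ω) = b s
          then 1 else 0) ∂μ = ∫⁻ ω, S.hybrid μ a f R' T b ω ∂μ := by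
    have hF : Measurable fun p : (Fin T → Fin 2) → (Fin T → Cov d) × (Fin T → Fin 2) × ℝ =>
        R ((p b).1, b) (p b).2.2 :=
      hR.comp (((measurable_pi_apply b).fst.prodMk measurable_const).prodMk
        (measurable_pi_apply b).snd.snd)
    rw [← lintegral_hybrid hSR hf hf01 hpos hR'm b le_rfl]
    simp_rw [S.pastUnder_static b]
    refine (lintegral_prod_flipValue hf hf01 hV hV_unif hV_indep hV_pot hF b).trans
      (lintegral_congr fun ω => ?_)
    simp only [hybrid, hybridFactor, staticFrom_zero, Nat.not_lt_zero, if_false]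
    rw [S.pastUnder_static b]
    congr 1
    rw [hR', ← S.pastUnder_static b]
    rfl
  simp_rw [apply_flip_eq_sum]
  have hsummand (b : Fin T → Fin 2) : Measurable fun ω => R (S.pastUnder (static Ω d b) T ω)
      (S.outcomeUnder (static Ω d b) ω) * ∏ s : Fin T, (if flipValue a f s
        (S.histUnder (static Ω d b) s ω) (S.naturalUnder (static Ω d b) s ω) (V s ω) = b s
          then (1 : ℝ≥0∞) else 0) :=
    (hRs b).mul (Finset.measurable_prod _ fun s _ =>
      Measurable.ite (hflip b s (measurableSet_singleton (b s))) measurable_const measurable_const)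
  rw [lintegral_finsetSum _ fun b _ => hsummand b]
  simp_rw [hterm]
  have hhyb (b : Fin T → Fin 2) : Measurable (S.hybrid μ a f R' T b) := by
    refine (hR'm.comp ((S.measurable_pastUnder (t := T) fun s hs => ?_).prodMk S.measurable_UY)).mul
      (Finset.measurable_prod _ fun s _ => ?_)
    · unfold RegimeMeasurable staticFrom
      simp only [hs, if_true]
      exact measurable_snd.snd
    · unfold hybridFactor
      simp only [s.isLt, if_true]
      exact ((S.measurable_weight μ a f (hf s s.isLt) (b s)).comp (S.measurable_H s)).indicator
        (S.measurable_A s (measurableSet_singleton (b s)))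
  rw [← lintegral_finsetSum _ fun b _ => hhyb b]
  refine lintegral_congr fun ω => ?_
  rw [sum_hybrid hf01, mul_comm]
  rfl

end Flip

/-! ### The g-formula for the reweighted observed law -/

section Observed

variable (S : NPSEM Ω d T EX EA EY) (μ : Measure Ω) (a : ℕ → Fin 2)
  (f : ∀ t : ℕ, Hist d t → ℝ)

instance isMarkovKernel_covKernel [IsFiniteMeasure μ] (t : ℕ) (b : Fin t → Fin 2) :
    IsMarkovKernel (S.covKernel μ t b) := by
  unfold covKernel
  infer_instance

theorem isProbabilityMeasure_histLaw_of_pastLaw [IsFiniteMeasure μ] (t : ℕ) (b : Fin t → Fin 2)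
    (h : IsProbabilityMeasure (S.pastLaw μ t b)) : IsProbabilityMeasure (S.histLaw μ t b) :=
   Measure.isProbabilityMeasure_map (measurable_finSnoc t).aemeasurable

instance isProbabilityMeasure_pastLaw [IsFiniteMeasure μ] (t : ℕ) (b : Fin t → Fin 2) :
    IsProbabilityMeasure (S.pastLaw μ t b) := by
  induction t with
  | zero => unfold pastLaw; infer_instance
  | succ t ih => exact S.isProbabilityMeasure_histLaw_of_pastLaw μ t (Fin.init b) (ih _)

theorem lintegral_histLaw [IsFiniteMeasure μ] (t : ℕ) (b : Fin t → Fin 2)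
    {G : (Fin (t + 1) → Cov d) → ℝ≥0∞} (hG : Measurable G) :
    ∫⁻ x, G x ∂S.histLaw μ t b = ∫⁻ x, ∫⁻ y, G (Fin.snoc (α := fun _ => Cov d) x y)
      ∂condDistrib (S.X t) (S.past t) μ (x, b) ∂S.pastLaw μ t b := by
  have h : Measurable fun p : (Fin t → Cov d) × Cov d =>
      G (Fin.snoc (α := fun _ => Cov d) p.1 p.2) := hG.comp (measurable_finSnoc t)
  rw [histLaw, lintegral_map hG (measurable_finSnoc t), Measure.lintegral_compProd h]
  rfl

/-- Integrating a function of the history by conditioning the last covariate on the past. -/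
theorem lintegral_hist_condDistrib [IsFiniteMeasure μ] (t : ℕ) {W : Past d t → ℝ≥0∞}
    (hW : Measurable W) {G : Hist d t → ℝ≥0∞} (hG : Measurable G) :
    ∫⁻ ω, W (S.past t ω) * G (S.H t ω) ∂μ =
      ∫⁻ ω, W (S.past t ω) * ∫⁻ y, G (Fin.snoc (α := fun _ => Cov d) (S.past t ω).1 y,
        (S.past t ω).2) ∂condDistrib (S.X t) (S.past t) μ (S.past t ω) ∂μ := by
  have hs : Measurable fun q : Past d t × Cov d =>
      G (Fin.snoc (α := fun _ => Cov d) q.1.1 q.2, q.1.2) :=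
    hG.comp ((measurable_fst.fst.finSnoc measurable_snd).prodMk measurable_fst.snd)
  have hq : Measurable fun q : Past d t × Cov d =>
      W q.1 * G (Fin.snoc (α := fun _ => Cov d) q.1.1 q.2, q.1.2) := (hW.comp measurable_fst).mul hs
  have hin : Measurable fun p : Past d t => ∫⁻ y, G (Fin.snoc (α := fun _ => Cov d) p.1 y, p.2)
      ∂condDistrib (S.X t) (S.past t) μ p := hs.lintegral_kernel_prod_right'
  calc ∫⁻ ω, W (S.past t ω) * G (S.H t ω) ∂μ
      = ∫⁻ q, W q.1 * G (Fin.snoc (α := fun _ => Cov d) q.1.1 q.2, q.1.2)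
          ∂(μ.map fun ω => (S.past t ω, S.X t ω)) :=
        (lintegral_map hq ((S.measurable_past t).prodMk (S.measurable_X t))).symm
    _ = ∫⁻ p, W p * ∫⁻ y, G (Fin.snoc (α := fun _ => Cov d) p.1 y, p.2)
          ∂condDistrib (S.X t) (S.past t) μ p ∂(μ.map (S.past t)) := by
        rw [← compProd_map_condDistrib (S.measurable_X t).aemeasurable,
          Measure.lintegral_compProd hq]
        refine lintegral_congr fun p => ?_
        have hp : Measurable fun y : Cov d => G (Fin.snoc (α := fun _ => Cov d) p.1 y, p.2) :=
          hs.comp (measurable_const.prodMk measurable_id)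
        dsimp only
        rw [lintegral_const_mul _ hp]
    _ = _ := lintegral_map (hW.mul hin) (S.measurable_past t)

theorem measurable_QProd [IsFiniteMeasure μ] {n : ℕ} (hf : ∀ t < n, Measurable (f t))
    (b : Fin n → Fin 2) : Measurable fun x : Fin n → Cov d => S.QProd μ a f x b :=
  Finset.measurable_prod _ fun s _ =>
    (S.measurable_Q μ a f (hf s s.isLt) (b s)).comp (measurable_cutHist b s)

theorem QProd_nonneg [IsFiniteMeasure μ] {n : ℕ} (hf : ∀ t < n, ∀ h, f t h ∈ Set.Icc (0 : ℝ) 1)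
    (x : Fin n → Cov d) (b : Fin n → Fin 2) : 0 ≤ S.QProd μ a f x b :=
  Finset.prod_nonneg fun s _ => S.Q_nonneg μ a f (hf s s.isLt _) _

theorem QProd_snoc [IsFiniteMeasure μ] {n : ℕ} (x : Fin (n + 1) → Cov d) (b : Fin n → Fin 2)
    (c : Fin 2) : S.QProd μ a f x (Fin.snoc (α := fun _ => Fin 2) b c) =
      S.Q μ a f n c (x, b) * S.QProd μ a f (Fin.init x) b := by
  have hcut (j : Fin n) : cutHist x (Fin.snoc (α := fun _ => Fin 2) b c) j.castSucc =
      cutHist (Fin.init x) b j := by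
    refine Prod.ext rfl (funext fun i => ?_)
    exact Fin.snoc_castSucc (α := fun _ => Fin 2) c b (i.castLE j.isLt.le)
  have hlast : cutHist x (Fin.snoc (α := fun _ => Fin 2) b c) (Fin.last n) = (x, b) := by
    refine Prod.ext rfl (funext fun i => ?_)
    exact Fin.snoc_castSucc (α := fun _ => Fin 2) c b i
  rw [QProd, Fin.prod_univ_castSucc, mul_comm, QProd, hlast, Fin.snoc_last]
  congr 1
  refine Finset.prod_congr rfl fun j _ => ?_
  rw [hcut, Fin.snoc_castSucc]
  rfl

variable {S μ a f}

/-- Summing out the treatment at timepoint `t` turns its weight into intervention propensity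
scores. -/
theorem lintegral_weight_treat [IsFiniteMeasure μ] (hSR : S.StrongSequentialRandomization μ)
    {t : ℕ} (ht : t < T) (hf : Measurable (f t))
    (hpos : ∀ᵐ ω ∂μ, S.propensity μ t (a t) (S.H t ω) = 0 → f t (S.H t ω) = 0)
    {G : Fin 2 → Ω → ℝ≥0∞} (hG : ∀ b, Measurable[S.sigmaFuture t] (G b)) :
    ∫⁻ ω, S.weight μ a f t (S.A t ω) (S.H t ω) * G (S.A t ω) ω ∂μ =
      ∑ b, ∫⁻ ω, ENNReal.ofReal (S.Q μ a f t b (S.H t ω)) * G b ω ∂μ := by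
  rw [S.lintegral_eq_sum_treat μ (G := fun b ω => S.weight μ a f t b (S.H t ω) * G b ω)
    fun b => ((S.measurable_weight μ a f hf b).comp (S.measurable_H t)).mul
      ((hG b).mono (S.sigmaFuture_le t) le_rfl)]
  exact Finset.sum_congr rfl fun b _ => hSR.lintegral_weight ht hf hpos b (hG b)

theorem measurable_sigmaFuture_past (S : NPSEM Ω d T EX EA EY) (t : ℕ) :
    Measurable[S.sigmaFuture t] (S.past t) := by
  have he : S.past t = fun ω => (Fin.init (S.H t ω).1, (S.H t ω).2) := by
    funext ω
    rw [H_eq, Fin.init_snoc]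
  have hcut : Measurable fun h : Hist d t => ((Fin.init h.1, h.2) : Past d t) :=
    (measurable_pi_iff.2 fun i => (measurable_pi_apply i.castSucc).comp measurable_fst).prodMk
      measurable_snd
  rw [he]
  exact hcut.comp (S.measurable_sigmaFuture_H t)

/-- The weights of later timepoints integrate out. -/
theorem lintegral_ipw_mul [IsFiniteMeasure μ] (hSR : S.StrongSequentialRandomization μ)
    (hf : ∀ t < T, Measurable (f t)) (hf01 : ∀ t < T, ∀ h, f t h ∈ Set.Icc (0 : ℝ) 1)
    (hpos : ∀ t < T, ∀ᵐ ω ∂μ, S.propensity μ t (a t) (S.H t ω) = 0 → f t (S.H t ω) = 0)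
    {n m : ℕ} (hnm : n ≤ m) (hm : m ≤ T) {G : Ω → ℝ≥0∞}
    (hG : ∀ k, n ≤ k → Measurable[S.sigmaFuture k] G) :
    ∫⁻ ω, ENNReal.ofReal (S.ipw μ a f m ω) * G ω ∂μ =
      ∫⁻ ω, ENNReal.ofReal (S.ipw μ a f n ω) * G ω ∂μ := by
  induction m, hnm using Nat.le_induction with
  | base => rfl
  | succ m hnm ih =>
    rw [← ih (m.le_succ.trans hm)]
    simp_rw [← S.pastWeight_past μ a f fun s hs => hf01 s (hs.trans_le hm),
      ← S.pastWeight_past μ a f fun s hs => hf01 s (hs.trans_le (m.le_succ.trans hm))]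
    have hW : Measurable[S.sigmaFuture m] fun ω => S.pastWeight μ a f (S.past m ω) * G ω :=
      ((S.measurable_pastWeight μ a f fun s hs => hf s (hs.trans hm)).comp
        (S.measurable_sigmaFuture_past m)).mul (hG m hnm)
    have h := lintegral_weight_treat hSR hm (hf m hm) (hpos m hm) (G := fun _ ω =>
      S.pastWeight μ a f (S.past m ω) * G ω) fun _ => hW
    have hQ (b : Fin 2) : Measurable fun ω => ENNReal.ofReal (S.Q μ a f m b (S.H m ω)) *
        (S.pastWeight μ a f (S.past m ω) * G ω) :=
      ((S.measurable_Q μ a f (hf m hm) b).comp (S.measurable_H m)).ennreal_ofReal.mul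
        (hW.mono (S.sigmaFuture_le m) le_rfl)
    rw [← lintegral_finsetSum _ fun b _ => hQ b] at h
    refine Eq.trans (lintegral_congr fun ω => ?_) (h.trans (lintegral_congr fun ω => ?_))
    · rw [pastWeight_past_succ]
      ring
    · rw [← Finset.sum_mul,
        ← ENNReal.ofReal_sum_of_nonneg fun b _ => S.Q_nonneg μ a f (hf01 m hm _) b, sum_Q,
        ENNReal.ofReal_one, one_mul]

/-- The covariate step of the g-formula: its law given the past is not affected by the weights. -/
theorem lintegral_hist_of_past [IsFiniteMeasure μ]
    (hf : ∀ t < T, Measurable (f t)) (hf01 : ∀ t < T, ∀ h, f t h ∈ Set.Icc (0 : ℝ) 1)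
    {t : ℕ} (ht : t ≤ T)
    (hpast : ∀ G : Past d t → ℝ≥0∞, Measurable G →
      ∫⁻ ω, ENNReal.ofReal (S.ipw μ a f t ω) * G (S.past t ω) ∂μ =
        ∑ b, ∫⁻ x, ENNReal.ofReal (S.QProd μ a f x b) * G (x, b) ∂S.pastLaw μ t b)
    {G : Hist d t → ℝ≥0∞} (hG : Measurable G) :
    ∫⁻ ω, ENNReal.ofReal (S.ipw μ a f t ω) * G (S.H t ω) ∂μ =
      ∑ b, ∫⁻ x, ENNReal.ofReal (S.QProd μ a f (Fin.init x) b) * G (x, b)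
        ∂S.histLaw μ t b := by
  have hft : ∀ s < t, Measurable (f s) := fun s hs => hf s (hs.trans_le ht)
  have hs : Measurable fun q : Past d t × Cov d =>
      G (Fin.snoc (α := fun _ => Cov d) q.1.1 q.2, q.1.2) :=
    hG.comp ((measurable_fst.fst.finSnoc measurable_snd).prodMk measurable_fst.snd)
  have hin : Measurable fun p : Past d t => ∫⁻ y, G (Fin.snoc (α := fun _ => Cov d) p.1 y, p.2)
      ∂condDistrib (S.X t) (S.past t) μ p := hs.lintegral_kernel_prod_right'
  have hpast' := hpast _ hin
  simp_rw [← S.pastWeight_past μ a f fun s hs => hf01 s (hs.trans_le ht)] at hpast' ⊢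
  rw [S.lintegral_hist_condDistrib μ t (S.measurable_pastWeight μ a f hft) hG, hpast']
  refine Finset.sum_congr rfl fun b _ => ?_
  have hinit : Measurable fun x : Fin (t + 1) → Cov d => Fin.init (α := fun _ => Cov d) x :=
    measurable_pi_iff.2 fun i => measurable_pi_apply i.castSucc
  have hQ : Measurable fun x : Fin (t + 1) → Cov d =>
      ENNReal.ofReal (S.QProd μ a f (Fin.init x) b) :=
    ((S.measurable_QProd μ a f hft b).comp hinit).ennreal_ofReal
  have hGb : Measurable fun x => G (x, b) := hG.comp (measurable_id.prodMk measurable_const)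
  have hQG : Measurable fun x => ENNReal.ofReal (S.QProd μ a f (Fin.init x) b) * G (x, b) :=
    hQ.mul hGb
  rw [S.lintegral_histLaw μ t b hQG]
  refine lintegral_congr fun x => ?_
  have hx : Measurable fun y : Cov d => G (Fin.snoc (α := fun _ => Cov d) x y, b) :=
    hGb.comp (measurable_const.finSnoc measurable_id)
  simp_rw [Fin.init_snoc]
  exact (lintegral_const_mul _ hx).symm

/-- The treatment step of the g-formula: the weight replaces the propensity score by `Q_t`. -/
theorem lintegral_past_of_hist [IsFiniteMeasure μ] (hSR : S.StrongSequentialRandomization μ)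
    (hf : ∀ t < T, Measurable (f t)) (hf01 : ∀ t < T, ∀ h, f t h ∈ Set.Icc (0 : ℝ) 1)
    (hpos : ∀ t < T, ∀ᵐ ω ∂μ, S.propensity μ t (a t) (S.H t ω) = 0 → f t (S.H t ω) = 0)
    {t : ℕ} (ht : t < T)
    (hhist : ∀ G : Hist d t → ℝ≥0∞, Measurable G →
      ∫⁻ ω, ENNReal.ofReal (S.ipw μ a f t ω) * G (S.H t ω) ∂μ =
        ∑ b, ∫⁻ x, ENNReal.ofReal (S.QProd μ a f (Fin.init x) b) * G (x, b) ∂S.histLaw μ t b)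
    {G : Past d (t + 1) → ℝ≥0∞} (hG : Measurable G) :
    ∫⁻ ω, ENNReal.ofReal (S.ipw μ a f (t + 1) ω) * G (S.past (t + 1) ω) ∂μ =
      ∑ b, ∫⁻ x, ENNReal.ofReal (S.QProd μ a f x b) * G (x, b) ∂S.pastLaw μ (t + 1) b := by
  have hft : ∀ s < t, Measurable (f s) := fun s hs => hf s (hs.trans ht)
  have hcons (c : Fin 2) : Measurable fun h : Hist d t =>
      G (h.1, Fin.snoc (α := fun _ => Fin 2) h.2 c) :=
    hG.comp (measurable_fst.prodMk (measurable_snd.finSnoc measurable_const))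
  have hGQ (c : Fin 2) : Measurable fun h : Hist d t => ENNReal.ofReal (S.Q μ a f t c h) *
      G (h.1, Fin.snoc (α := fun _ => Fin 2) h.2 c) :=
    (S.measurable_Q μ a f (hf t ht) c).ennreal_ofReal.mul (hcons c)
  have hm (c : Fin 2) : Measurable[S.sigmaFuture t] fun ω => S.pastWeight μ a f (S.past t ω) *
      G ((S.H t ω).1, Fin.snoc (α := fun _ => Fin 2) (S.H t ω).2 c) :=
    ((S.measurable_pastWeight μ a f hft).comp (S.measurable_sigmaFuture_past t)).mul
      ((hcons c).comp (S.measurable_sigmaFuture_H t))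
  calc ∫⁻ ω, ENNReal.ofReal (S.ipw μ a f (t + 1) ω) * G (S.past (t + 1) ω) ∂μ
      = ∫⁻ ω, S.weight μ a f t (S.A t ω) (S.H t ω) * (S.pastWeight μ a f (S.past t ω) *
          G ((S.H t ω).1, Fin.snoc (α := fun _ => Fin 2) (S.H t ω).2 (S.A t ω))) ∂μ := by
        refine lintegral_congr fun ω => ?_
        rw [← S.pastWeight_past μ a f fun s hs => hf01 s (hs.trans_le ht), pastWeight_past_succ,
          mul_comm (S.pastWeight μ a f _), mul_assoc]
        rfl
    _ = ∑ c, ∫⁻ ω, ENNReal.ofReal (S.ipw μ a f t ω) *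
          (ENNReal.ofReal (S.Q μ a f t c (S.H t ω)) *
          G ((S.H t ω).1, Fin.snoc (α := fun _ => Fin 2) (S.H t ω).2 c)) ∂μ := by
        rw [lintegral_weight_treat hSR ht (hf t ht) (hpos t ht) hm]
        refine Finset.sum_congr rfl fun c _ => lintegral_congr fun ω => ?_
        rw [S.pastWeight_past μ a f fun s hs => hf01 s (hs.trans ht)]
        ring
    _ = ∑ c, ∑ b, ∫⁻ x, ENNReal.ofReal (S.QProd μ a f (Fin.init x) b) *
          (ENNReal.ofReal (S.Q μ a f t c (x, b)) *
          G (x, Fin.snoc (α := fun _ => Fin 2) b c)) ∂S.histLaw μ t b :=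
        Finset.sum_congr rfl fun c _ => hhist _ (hGQ c)
    _ = _ := by
        rw [sum_path_succ]
        refine Finset.sum_congr rfl fun c _ => Finset.sum_congr rfl fun b _ => ?_
        have hlaw : S.pastLaw μ (t + 1) (Fin.snoc (α := fun _ => Fin 2) b c) =
            S.histLaw μ t b := by
          rw [pastLaw, Fin.init_snoc, histLaw]
        rw [hlaw]
        refine lintegral_congr fun x => ?_
        rw [QProd_snoc, ENNReal.ofReal_mul (S.Q_nonneg μ a f (hf01 t ht _) c)]
        ring

/-- The g-formula for the law of the past under the inverse probability weight. -/
theorem lintegral_past [IsProbabilityMeasure μ] (hSR : S.StrongSequentialRandomization μ)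
    (hf : ∀ t < T, Measurable (f t)) (hf01 : ∀ t < T, ∀ h, f t h ∈ Set.Icc (0 : ℝ) 1)
    (hpos : ∀ t < T, ∀ᵐ ω ∂μ, S.propensity μ t (a t) (S.H t ω) = 0 → f t (S.H t ω) = 0)
    {t : ℕ} (ht : t ≤ T) {G : Past d t → ℝ≥0∞} (hG : Measurable G) :
    ∫⁻ ω, ENNReal.ofReal (S.ipw μ a f t ω) * G (S.past t ω) ∂μ =
      ∑ b, ∫⁻ x, ENNReal.ofReal (S.QProd μ a f x b) * G (x, b) ∂S.pastLaw μ t b := by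
  induction t with
  | zero =>
    have hp (ω : Ω) : S.past 0 ω = (Fin.elim0, Fin.elim0) := rfl
    have hb (b : Fin 0 → Fin 2) : b = Fin.elim0 := funext fun i => i.elim0
    have hGx : Measurable fun x : Fin 0 → Cov d => G (x, Fin.elim0) :=
      hG.comp (measurable_id.prodMk measurable_const)
    rw [Fintype.sum_eq_single Fin.elim0 fun b h => absurd (hb b) h]
    simp [hp, ipw, QProd, pastLaw, lintegral_dirac' _ hGx]
  | succ t ih =>
    exact lintegral_past_of_hist hSR hf hf01 hpos ht
      (fun G hG => lintegral_hist_of_past hf hf01 (t.le_succ.trans ht)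
        (fun G hG => ih (t.le_succ.trans ht) hG) hG) hG

/-- The g-formula for the law of the history under the inverse probability weight. -/
theorem lintegral_hist [IsProbabilityMeasure μ] (hSR : S.StrongSequentialRandomization μ)
    (hf : ∀ t < T, Measurable (f t)) (hf01 : ∀ t < T, ∀ h, f t h ∈ Set.Icc (0 : ℝ) 1)
    (hpos : ∀ t < T, ∀ᵐ ω ∂μ, S.propensity μ t (a t) (S.H t ω) = 0 → f t (S.H t ω) = 0)
    {t : ℕ} (ht : t ≤ T) {G : Hist d t → ℝ≥0∞} (hG : Measurable G) :
    ∫⁻ ω, ENNReal.ofReal (S.ipw μ a f t ω) * G (S.H t ω) ∂μ =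
      ∑ b, ∫⁻ x, ENNReal.ofReal (S.QProd μ a f (Fin.init x) b) * G (x, b) ∂S.histLaw μ t b :=
  lintegral_hist_of_past hf hf01 ht (fun _ hG => lintegral_past hSR hf hf01 hpos ht hG) hG

end Observed

end NPSEM

/-! ### Conditional distributions under reweighting -/

/-- Reweighting by a function of `X` does not change the conditional distribution given `X`. -/
theorem map_withDensity_comp_eq_compProd {Ω α β : Type*} [MeasurableSpace Ω] [MeasurableSpace α]
    [MeasurableSpace β] [StandardBorelSpace β] [Nonempty β] {μ : Measure Ω} [IsFiniteMeasure μ]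
    {X : Ω → α} {Y : Ω → β} (hX : Measurable X) (hY : Measurable Y) {W : α → ℝ≥0∞}
    (hW : Measurable W) :
    (μ.withDensity fun ω => W (X ω)).map (fun ω => (X ω, Y ω)) =
      ((μ.withDensity fun ω => W (X ω)).map X).compProd (condDistrib Y X μ) := by
  have hWX : Measurable fun ω => W (X ω) := hW.comp hX
  refine Measure.ext_of_lintegral _ fun g hg => ?_
  have hgXY : Measurable fun ω => g (X ω, Y ω) := hg.comp (hX.prodMk hY)
  have hin : Measurable fun x => ∫⁻ y, g (x, y) ∂condDistrib Y X μ x :=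
    hg.lintegral_kernel_prod_right'
  have hinX : Measurable fun ω => ∫⁻ y, g (X ω, y) ∂condDistrib Y X μ (X ω) := hin.comp hX
  have hWg : Measurable fun q : α × β => W q.1 * g q := (hW.comp measurable_fst).mul hg
  rw [lintegral_map hg (hX.prodMk hY), lintegral_withDensity_eq_lintegral_mul _ hWX hgXY,
    Measure.lintegral_compProd hg, lintegral_map hin hX,
    lintegral_withDensity_eq_lintegral_mul _ hWX hinX]
  calc ∫⁻ ω, W (X ω) * g (X ω, Y ω) ∂μ
      = ∫⁻ q, W q.1 * g q ∂(μ.map fun ω => (X ω, Y ω)) :=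
        (lintegral_map hWg (hX.prodMk hY)).symm
    _ = ∫⁻ x, W x * ∫⁻ y, g (x, y) ∂condDistrib Y X μ x ∂(μ.map X) := by
        rw [← compProd_map_condDistrib hY.aemeasurable, Measure.lintegral_compProd hWg]
        refine lintegral_congr fun x => ?_
        have hgx : Measurable fun y => g (x, y) := hg.comp (measurable_const.prodMk measurable_id)
        dsimp only
        rw [lintegral_const_mul _ hgx]
    _ = _ := lintegral_map (hW.mul hin) hX

theorem integrable_of_lintegral_ofReal_ne_top {α : Type*} [MeasurableSpace α] {μ : Measure α}
    {g : α → ℝ} (hg : Measurable g) (h0 : ∀ x, 0 ≤ g x) (h : ∫⁻ x, ENNReal.ofReal (g x) ∂μ ≠ ∞) :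
    Integrable g μ :=
  (lintegral_ofReal_ne_top_iff_integrable hg.aestronglyMeasurable
    (Filter.Eventually.of_forall h0)).1 h

namespace NPSEM

variable {Ω : Type*} [MeasurableSpace Ω] {d T : ℕ} {EX EA : ℕ → Type*} {EY : Type*}
  [∀ t, MeasurableSpace (EX t)] [∀ t, MeasurableSpace (EA t)] [MeasurableSpace EY]

/-! ### Identification of the means -/

section Means

variable {S : NPSEM Ω d T EX EA EY} {μ : Measure Ω} [IsProbabilityMeasure μ] {a : ℕ → Fin 2}
  {f : ∀ t : ℕ, Hist d t → ℝ} {V : ℕ → Ω → ℝ}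

theorem measurable_ipw {n : ℕ} (hf : ∀ t < n, Measurable (f t))
    (hf01 : ∀ t < n, ∀ h, f t h ∈ Set.Icc (0 : ℝ) 1) : Measurable (S.ipw μ a f n) := by
  have he : S.ipw μ a f n = fun ω => (S.pastWeight μ a f (S.past n ω)).toReal := by
    funext ω
    rw [S.pastWeight_past μ a f hf01, ENNReal.toReal_ofReal (S.ipw_nonneg μ a f hf01 ω)]
  rw [he]
  exact ((S.measurable_pastWeight μ a f hf).comp (S.measurable_past n)).ennreal_toReal

/-- The g-formula for the outcome. The weight is a function of the past, so the conditional
distribution of `Y` given the past is the same under the reweighted law; only there is `Y` assumed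
to be integrable. -/
theorem integral_outcomeRegression (hSR : S.StrongSequentialRandomization μ)
    (hf : ∀ t < T, Measurable (f t)) (hf01 : ∀ t < T, ∀ h, f t h ∈ Set.Icc (0 : ℝ) 1)
    (hpos : ∀ t < T, ∀ᵐ ω ∂μ, S.propensity μ t (a t) (S.H t ω) = 0 → f t (S.H t ω) = 0)
    (hY : Integrable S.Y (μ.withDensity fun ω => ENNReal.ofReal (S.ipw μ a f T ω))) :
    (∀ b : Fin T → Fin 2,
      Integrable (fun x => S.outcomeRegression μ x b * S.QProd μ a f x b) (S.pastLaw μ T b)) ∧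
    ∫ ω, S.Y ω ∂(μ.withDensity fun ω => ENNReal.ofReal (S.ipw μ a f T ω)) =
      ∑ b : Fin T → Fin 2,
        ∫ x, S.outcomeRegression μ x b * S.QProd μ a f x b ∂(S.pastLaw μ T b) := by
  have hX := S.measurable_past T
  have hYm := S.measurable_Y
  set ν := μ.withDensity fun ω => ENNReal.ofReal (S.ipw μ a f T ω) with hν
  have hw : Measurable fun ω => ENNReal.ofReal (S.ipw μ a f T ω) :=
    (measurable_ipw hf hf01).ennreal_ofReal
  have hjoint : ν.map (fun ω => (S.past T ω, S.Y ω)) =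
      (ν.map (S.past T)).compProd (condDistrib S.Y (S.past T) μ) := by
    have h := map_withDensity_comp_eq_compProd (μ := μ) hX hYm (S.measurable_pastWeight μ a f hf)
    simp_rw [S.pastWeight_past μ a f hf01] at h
    exact h
  have hsnd : Integrable (fun q : Past d T × ℝ => q.2)
      ((ν.map (S.past T)).compProd (condDistrib S.Y (S.past T) μ)) := by
    rw [← hjoint]
    exact (integrable_map_measure measurable_snd.aestronglyMeasurable
      (hX.prodMk hYm).aemeasurable).2 hY
  set m : Past d T → ℝ := fun p => ∫ y, y ∂condDistrib S.Y (S.past T) μ p with hm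
  have hmi : Integrable m (ν.map (S.past T)) := Integrable.integral_compProd hsnd
  have hmm : Measurable m :=
    (StronglyMeasurable.integral_condDistrib (f := fun q : Past d T × ℝ => q.2)
      measurable_snd.stronglyMeasurable).measurable
  have hYint : ∫ ω, S.Y ω ∂ν = ∫ p, m p ∂(ν.map (S.past T)) := by
    rw [hm, ← Measure.integral_compProd hsnd, ← hjoint,
      integral_map (hX.prodMk hYm).aemeasurable measurable_snd.aestronglyMeasurable]
  have hQm (b : Fin T → Fin 2) : Measurable fun x => ENNReal.ofReal (S.QProd μ a f x b) :=
    (S.measurable_QProd μ a f hf b).ennreal_ofReal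
  have hpair (b : Fin T → Fin 2) : Measurable fun x : Fin T → Cov d => (x, b) :=
    measurable_id.prodMk measurable_const
  have hlaw : ν.map (S.past T) = ∑ b : Fin T → Fin 2, ((S.pastLaw μ T b).withDensity
      fun x => ENNReal.ofReal (S.QProd μ a f x b)).map fun x => (x, b) := by
    refine Measure.ext_of_lintegral _ fun G hG => ?_
    have hGb (b : Fin T → Fin 2) : Measurable fun x => G (x, b) := hG.comp (hpair b)
    have hGX : Measurable fun ω => G (S.past T ω) := hG.comp hX
    rw [lintegral_map hG hX, hν, lintegral_withDensity_eq_lintegral_mul _ hw hGX,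
      lintegral_finsetSum_measure]
    refine (lintegral_past hSR hf hf01 hpos le_rfl hG).trans (Finset.sum_congr rfl fun b _ => ?_)
    rw [lintegral_map hG (hpair b), lintegral_withDensity_eq_lintegral_mul _ (hQm b) (hGb b)]
    rfl
  have hterm (b : Fin T → Fin 2) : Integrable (fun x => m (x, b))
      ((S.pastLaw μ T b).withDensity fun x => ENNReal.ofReal (S.QProd μ a f x b)) := by
    rw [hlaw] at hmi
    exact (integrable_map_measure hmm.aestronglyMeasurable (hpair b).aemeasurable).1
      (integrable_finsetSum_measure.1 hmi b (Finset.mem_univ b))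
  have hfin (b : Fin T → Fin 2) : ∀ᵐ x ∂S.pastLaw μ T b,
      ENNReal.ofReal (S.QProd μ a f x b) < ∞ :=
    Filter.Eventually.of_forall fun _ => ENNReal.ofReal_lt_top
  have hreal (b : Fin T → Fin 2) (x : Fin T → Cov d) :
      (ENNReal.ofReal (S.QProd μ a f x b)).toReal = S.QProd μ a f x b :=
    ENNReal.toReal_ofReal (S.QProd_nonneg μ a f hf01 x b)
  refine ⟨fun b => ?_, ?_⟩
  · have h := (integrable_withDensity_iff (hQm b) (hfin b)).1 (hterm b)
    simp_rw [hreal] at h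
    exact h
  · rw [hYint, hlaw, integral_finsetSum_measure fun b _ =>
      (integrable_map_measure hmm.aestronglyMeasurable (hpair b).aemeasurable).2 (hterm b)]
    refine Finset.sum_congr rfl fun b _ => ?_
    rw [integral_map (hpair b).aemeasurable hmm.aestronglyMeasurable,
      integral_withDensity_eq_integral_toReal_smul (hQm b) (hfin b)]
    refine integral_congr_ae (Filter.Eventually.of_forall fun x => ?_)
    simp only [hreal, smul_eq_mul]
    exact mul_comm _ _

variable (hSR : S.StrongSequentialRandomization μ)
    (hf : ∀ t < T, Measurable (f t)) (hf01 : ∀ t < T, ∀ h, f t h ∈ Set.Icc (0 : ℝ) 1)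
    (hV : ∀ t < T, Measurable (V t))
    (hV_unif : ∀ t < T, pdf.IsUniform (V t) (Set.Icc (0 : ℝ) 1) μ volume)
    (hV_indep : iIndepFun (fun (t : Fin T) => V t) μ)
    (hV_pot : IndepFun (fun ω (t : Fin T) => V t ω) S.potentials μ)
    (hpos : ∀ t < T, ∀ᵐ ω ∂μ, S.propensity μ t (a t) (S.H t ω) = 0 → f t (S.H t ω) = 0)
include hSR hf hf01 hV hV_unif hV_indep hV_pot hpos

theorem map_outcomeUnder_flip : μ.map (S.outcomeUnder (flip a f V)) =
    (μ.withDensity fun ω => ENNReal.ofReal (S.ipw μ a f T ω)).map S.Y := by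
  have hYD : Measurable (S.outcomeUnder (flip a f V)) :=
    S.measurable_outcomeUnder fun s hs => regimeMeasurable_flip (hf s hs) (hV s hs)
  refine Measure.ext_of_lintegral _ fun g hg => ?_
  have hgY : Measurable fun ω => g (S.Y ω) := hg.comp S.measurable_Y
  rw [lintegral_map hg hYD, lintegral_map hg S.measurable_Y,
    lintegral_withDensity_eq_lintegral_mul _ (measurable_ipw hf hf01).ennreal_ofReal hgY]
  exact lintegral_flip hSR hf hf01 hV hV_unif hV_indep hV_pot hpos (R := fun _ y => g y)
    (hg.comp measurable_snd)

/-- The weights after `t` integrate out, and summing out the treatment at `t` leaves `Q_t(1 | H_t)`. -/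
theorem lintegral_treatUnder_flip {t : ℕ} (ht : t < T) :
    ∫⁻ ω, ENNReal.ofReal ((S.treatUnder (flip a f V) t ω : ℕ) : ℝ) ∂μ =
      ∫⁻ ω, ENNReal.ofReal (S.ipw μ a f t ω) * ENNReal.ofReal (S.Q μ a f t 1 (S.H t ω)) ∂μ := by
  have hft : ∀ s < t, Measurable (f s) := fun s hs => hf s (hs.trans ht)
  have hval : Measurable fun c : Fin 2 => ENNReal.ofReal ((c : ℕ) : ℝ) := measurable_of_finite _
  have hR : Measurable (Function.uncurry fun (p : Past d T) (_ : ℝ) =>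
      ENNReal.ofReal ((p.2 ⟨t, ht⟩ : ℕ) : ℝ)) :=
    hval.comp ((measurable_pi_apply _).comp measurable_fst.snd)
  have h := lintegral_flip hSR hf hf01 hV hV_unif hV_indep hV_pot hpos hR
  simp_rw [S.pastUnder_eq (flip a f V), S.past_snd] at h
  have hA (k : ℕ) (hk : t + 1 ≤ k) :
      Measurable[S.sigmaFuture k] fun ω => ENNReal.ofReal ((S.A t ω : ℕ) : ℝ) :=
    hval.comp (S.measurable_sigmaFuture_A hk)
  rw [h, lintegral_ipw_mul hSR hf hf01 hpos ht le_rfl hA]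
  have hG (c : Fin 2) : Measurable[S.sigmaFuture t] fun ω =>
      S.pastWeight μ a f (S.past t ω) * ENNReal.ofReal ((c : ℕ) : ℝ) :=
    ((S.measurable_pastWeight μ a f hft).comp (S.measurable_sigmaFuture_past t)).mul
      measurable_const
  have hw := lintegral_weight_treat hSR ht (hf t ht) (hpos t ht) hG
  rw [Fin.sum_univ_two] at hw
  refine Eq.trans (lintegral_congr fun ω => ?_) (hw.trans ?_)
  · rw [← S.pastWeight_past μ a f fun s hs => hf01 s (hs.trans_le ht), pastWeight_past_succ]
    ring
  · simp only [S.pastWeight_past μ a f fun s hs => hf01 s (hs.trans ht)]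
    simp [mul_comm]

theorem integral_treatUnder_flip {t : ℕ} (ht : t < T) :
    (∀ b : Fin t → Fin 2,
      Integrable (fun x => S.Q μ a f t 1 (x, b) * S.QProd μ a f (Fin.init x) b)
        (S.histLaw μ t b)) ∧
    Integrable (fun ω => S.Q μ a f t 1 (S.H t ω) * S.ipw μ a f t ω) μ ∧
    ∫ ω, ((S.treatUnder (flip a f V) t ω : ℕ) : ℝ) ∂μ =
      ∑ b : Fin t → Fin 2,
        ∫ x, S.Q μ a f t 1 (x, b) * S.QProd μ a f (Fin.init x) b ∂(S.histLaw μ t b) ∧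
    ∫ ω, ((S.treatUnder (flip a f V) t ω : ℕ) : ℝ) ∂μ =
      ∫ ω, S.Q μ a f t 1 (S.H t ω) * S.ipw μ a f t ω ∂μ := by
  have hft : ∀ s < t, Measurable (f s) := fun s hs => hf s (hs.trans ht)
  have hft01 : ∀ s < t, ∀ h, f s h ∈ Set.Icc (0 : ℝ) 1 := fun s hs => hf01 s (hs.trans ht)
  have hQm := S.measurable_Q μ a f (hf t ht) 1
  have hQ0 (h : Hist d t) : 0 ≤ S.Q μ a f t 1 h := S.Q_nonneg μ a f (hf01 t ht h) 1
  have hDm : Measurable fun ω => ((S.treatUnder (flip a f V) t ω : ℕ) : ℝ) :=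
    (measurable_of_finite fun c : Fin 2 => ((c : ℕ) : ℝ)).comp
      (S.measurable_treatUnder_of_pastUnder (regimeMeasurable_flip (hf t ht) (hV t ht))
        (S.measurable_pastUnder fun s hs => regimeMeasurable_flip (hft s hs) (hV s (hs.trans ht))))
  have hD := lintegral_treatUnder_flip hSR hf hf01 hV hV_unif hV_indep hV_pot hpos ht
  have hg := lintegral_hist hSR hf hf01 hpos ht.le hQm.ennreal_ofReal
  have hDfin : ∫⁻ ω, ENNReal.ofReal ((S.treatUnder (flip a f V) t ω : ℕ) : ℝ) ∂μ ≠ ∞ := by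
    refine ne_top_of_le_ne_top (b := ∫⁻ _, 1 ∂μ) (by simp) (lintegral_mono fun ω => ?_)
    rw [← ENNReal.ofReal_one]
    refine ENNReal.ofReal_le_ofReal ?_
    exact_mod_cast Nat.le_of_lt_succ (S.treatUnder (flip a f V) t ω).isLt
  have hobs : ∀ ω, ENNReal.ofReal (S.ipw μ a f t ω) * ENNReal.ofReal (S.Q μ a f t 1 (S.H t ω)) =
      ENNReal.ofReal (S.Q μ a f t 1 (S.H t ω) * S.ipw μ a f t ω) := fun ω => by
    rw [ENNReal.ofReal_mul (hQ0 _), mul_comm]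
  have hform : ∀ (b : Fin t → Fin 2) (x : Fin (t + 1) → Cov d),
      ENNReal.ofReal (S.QProd μ a f (Fin.init x) b) * ENNReal.ofReal (S.Q μ a f t 1 (x, b)) =
      ENNReal.ofReal (S.Q μ a f t 1 (x, b) * S.QProd μ a f (Fin.init x) b) := fun b x => by
    rw [ENNReal.ofReal_mul (hQ0 _), mul_comm]
  simp_rw [hobs] at hD hg
  simp_rw [hform] at hg
  have hobs0 (ω : Ω) : 0 ≤ S.Q μ a f t 1 (S.H t ω) * S.ipw μ a f t ω :=
    mul_nonneg (hQ0 _) (S.ipw_nonneg μ a f hft01 ω)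
  have hform0 (b : Fin t → Fin 2) (x : Fin (t + 1) → Cov d) :
      0 ≤ S.Q μ a f t 1 (x, b) * S.QProd μ a f (Fin.init x) b :=
    mul_nonneg (hQ0 _) (S.QProd_nonneg μ a f hft01 _ b)
  have hobsm : Measurable fun ω => S.Q μ a f t 1 (S.H t ω) * S.ipw μ a f t ω :=
    (hQm.comp (S.measurable_H t)).mul (measurable_ipw hft hft01)
  have hinit : Measurable fun x : Fin (t + 1) → Cov d => Fin.init (α := fun _ => Cov d) x :=
    measurable_pi_iff.2 fun i => measurable_pi_apply i.castSucc
  have hformm (b : Fin t → Fin 2) : Measurable fun x : Fin (t + 1) → Cov d =>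
      S.Q μ a f t 1 (x, b) * S.QProd μ a f (Fin.init x) b :=
    (hQm.comp (measurable_id.prodMk measurable_const)).mul
      ((S.measurable_QProd μ a f hft b).comp hinit)
  have hformfin (b : Fin t → Fin 2) : ∫⁻ x, ENNReal.ofReal
      (S.Q μ a f t 1 (x, b) * S.QProd μ a f (Fin.init x) b) ∂(S.histLaw μ t b) ≠ ∞ :=
    ENNReal.sum_ne_top.1 (by rwa [← hg, ← hD]) b (Finset.mem_univ b)
  have hDint : ∫ ω, ((S.treatUnder (flip a f V) t ω : ℕ) : ℝ) ∂μ =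
      (∫⁻ ω, ENNReal.ofReal ((S.treatUnder (flip a f V) t ω : ℕ) : ℝ) ∂μ).toReal :=
    integral_eq_lintegral_of_nonneg_ae (Filter.Eventually.of_forall fun ω => Nat.cast_nonneg _)
      hDm.aestronglyMeasurable
  refine ⟨fun b => integrable_of_lintegral_ofReal_ne_top (hformm b) (hform0 b) (hformfin b),
    integrable_of_lintegral_ofReal_ne_top hobsm hobs0 (by rwa [← hD]), ?_, ?_⟩
  · rw [hDint, hD, hg, ENNReal.toReal_sum fun b _ => hformfin b]
    exact Finset.sum_congr rfl fun b _ => (integral_eq_lintegral_of_nonneg_ae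
      (Filter.Eventually.of_forall (hform0 b)) (hformm b).aestronglyMeasurable).symm
  · rw [hDint, hD]
    exact (integral_eq_lintegral_of_nonneg_ae
      (Filter.Eventually.of_forall hobs0) hobsm.aestronglyMeasurable).symm

theorem integral_outcomeUnder_flip (hint : Integrable (S.outcomeUnder (flip a f V)) μ) :
    (∀ b : Fin T → Fin 2,
      Integrable (fun x => S.outcomeRegression μ x b * S.QProd μ a f x b) (S.pastLaw μ T b)) ∧
    Integrable (fun ω => S.Y ω * S.ipw μ a f T ω) μ ∧
    ∫ ω, S.outcomeUnder (flip a f V) ω ∂μ =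
      ∑ b : Fin T → Fin 2,
        ∫ x, S.outcomeRegression μ x b * S.QProd μ a f x b ∂(S.pastLaw μ T b) ∧
    ∫ ω, S.outcomeUnder (flip a f V) ω ∂μ = ∫ ω, S.Y ω * S.ipw μ a f T ω ∂μ := by
  have hYD : Measurable (S.outcomeUnder (flip a f V)) :=
    S.measurable_outcomeUnder fun s hs => regimeMeasurable_flip (hf s hs) (hV s hs)
  have hlaw := map_outcomeUnder_flip hSR hf hf01 hV hV_unif hV_indep hV_pot hpos
  have hw : Measurable fun ω => ENNReal.ofReal (S.ipw μ a f T ω) :=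
    (measurable_ipw hf hf01).ennreal_ofReal
  have hfin : ∀ᵐ ω ∂μ, ENNReal.ofReal (S.ipw μ a f T ω) < ∞ :=
    Filter.Eventually.of_forall fun _ => ENNReal.ofReal_lt_top
  have hreal (ω : Ω) : (ENNReal.ofReal (S.ipw μ a f T ω)).toReal = S.ipw μ a f T ω :=
    ENNReal.toReal_ofReal (S.ipw_nonneg μ a f hf01 ω)
  have hY : Integrable S.Y (μ.withDensity fun ω => ENNReal.ofReal (S.ipw μ a f T ω)) := by
    have h : Integrable (fun y : ℝ => y) (μ.map (S.outcomeUnder (flip a f V))) :=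
      (integrable_map_measure measurable_id.aestronglyMeasurable hYD.aemeasurable).2 hint
    rw [hlaw] at h
    exact (integrable_map_measure measurable_id.aestronglyMeasurable
      S.measurable_Y.aemeasurable).1 h
  have hmean : ∫ ω, S.outcomeUnder (flip a f V) ω ∂μ =
      ∫ ω, S.Y ω ∂(μ.withDensity fun ω => ENNReal.ofReal (S.ipw μ a f T ω)) := by
    rw [← integral_map (f := fun y : ℝ => y) hYD.aemeasurable measurable_id.aestronglyMeasurable,
      hlaw, integral_map (f := fun y : ℝ => y) S.measurable_Y.aemeasurable
        measurable_id.aestronglyMeasurable]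
  obtain ⟨h1, h2⟩ := integral_outcomeRegression hSR hf hf01 hpos hY
  refine ⟨h1, ?_, hmean.trans h2, hmean.trans ?_⟩
  · have h := (integrable_withDensity_iff hw hfin).1 hY
    simp_rw [hreal] at h
    exact h
  · rw [integral_withDensity_eq_integral_toReal_smul hw hfin]
    simp_rw [hreal, smul_eq_mul, mul_comm]

end Means

end NPSEM
theorem mainTheorem2 {Ω : Type*} [MeasurableSpace Ω] {μ : Measure Ω} [IsProbabilityMeasure μ]
    {d T : ℕ} {EX EA : ℕ → Type*} {EY : Type*}
    [∀ t, MeasurableSpace (EX t)] [∀ t, MeasurableSpace (EA t)] [MeasurableSpace EY]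
    (S : NPSEM Ω d T EX EA EY)
    (hSR : S.StrongSequentialRandomization μ)
    -- the target regime and the weight functions
    (a : ℕ → Fin 2) (f : ∀ t : ℕ, Hist d t → ℝ)
    (hf_meas : ∀ t < T, Measurable (f t)) (hf_mem : ∀ t < T, ∀ h, f t h ∈ Set.Icc (0 : ℝ) 1)
    -- the auxiliary variables: iid uniform, independent of observed and potential variables
    (V : ℕ → Ω → ℝ) (hV_meas : ∀ t < T, Measurable (V t))
    (hV_unif : ∀ t < T, pdf.IsUniform (V t) (Set.Icc (0 : ℝ) 1) μ volume)
    (hV_indep : iIndepFun (fun (t : Fin T) => V t) μ)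
    (hV_pot : IndepFun (fun ω (t : Fin T) => V t ω) S.potentials μ)
    (hcond :
      (∀ t < T, ∀ᵐ ω ∂μ, S.propensity μ t (a t) (S.H t ω) = 0 → f t (S.H t ω) = 0) ∨
      (∀ t < T, μ {ω | S.propensity μ t (a t) (S.H t ω) = 0} = 0)) :
    (Integrable (S.outcomeUnder (NPSEM.flip a f V)) μ →
      (∀ b : Fin T → Fin 2,
        Integrable (fun x => S.outcomeRegression μ x b * S.QProd μ a f x b) (S.pastLaw μ T b)) ∧
      Integrable (fun ω => S.Y ω * S.ipw μ a f T ω) μ ∧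
      ∫ ω, S.outcomeUnder (NPSEM.flip a f V) ω ∂μ =
        ∑ b : Fin T → Fin 2,
          ∫ x, S.outcomeRegression μ x b * S.QProd μ a f x b ∂(S.pastLaw μ T b) ∧
      ∫ ω, S.outcomeUnder (NPSEM.flip a f V) ω ∂μ = ∫ ω, S.Y ω * S.ipw μ a f T ω ∂μ) ∧
    (∀ t < T,
      (∀ b : Fin t → Fin 2,
        Integrable (fun x => S.Q μ a f t 1 (x, b) * S.QProd μ a f (Fin.init x) b)
          (S.histLaw μ t b)) ∧
      Integrable (fun ω => S.Q μ a f t 1 (S.H t ω) * S.ipw μ a f t ω) μ ∧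
      ∫ ω, ((S.treatUnder (NPSEM.flip a f V) t ω : ℕ) : ℝ) ∂μ =
        ∑ b : Fin t → Fin 2,
          ∫ x, S.Q μ a f t 1 (x, b) * S.QProd μ a f (Fin.init x) b ∂(S.histLaw μ t b) ∧
      ∫ ω, ((S.treatUnder (NPSEM.flip a f V) t ω : ℕ) : ℝ) ∂μ =
        ∫ ω, S.Q μ a f t 1 (S.H t ω) * S.ipw μ a f t ω ∂μ) := by
  have hpos : ∀ t < T, ∀ᵐ ω ∂μ, S.propensity μ t (a t) (S.H t ω) = 0 → f t (S.H t ω) = 0 := by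
    rcases hcond with h | h
    · exact h
    -- if the propensity score of the target is almost surely nonzero, the implication is vacuous
    · intro t ht
      have hne : ∀ᵐ ω ∂μ, S.propensity μ t (a t) (S.H t ω) ≠ 0 := by
        rw [ae_iff]
        simpa using h t ht
      exact hne.mono fun ω hω h0 => absurd h0 hω
  exact ⟨fun hint => NPSEM.integral_outcomeUnder_flip hSR hf_meas hf_mem hV_meas hV_unif hV_indep
      hV_pot hpos hint,
    fun t ht => NPSEM.integral_treatUnder_flip hSR hf_meas hf_mem hV_meas hV_unif hV_indep
      hV_pot hpos ht⟩
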